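/- Let $\mathbb D$ be the open unit disk, $dA$ the area measure on $\mathbb D$ normalized so that $\mathbb D$ has measure $1$, and $|E|_\omega=\int_{E}\omega\,dA$ for $E\subset\mathbb D$. Let $0<\omega\in L^1(\mathbb D,dA)$ be a Muckenhoupt $\mathcal A_2$ weight, i.e. $$\sup_{a\in\mathbb D,\ 0<r<1}\frac{|B(a,r)|_\omega\,|B(a,r)|_{\omega^{-1}}}{|B(a,r)|^2}<\infty ,\qquad B(a,r)=\{z\in\mathbb D:|z-a|<r\},$$ let $L^2_h(\omega)$ be the space of complex-valued harmonic functions on $\mathbb D$ that lie in $L^2(\omega\,dA)$, with the inner product of $L^2(\omega\,dA)$, and let $K^\omega_z$ be its reproducing kernel, $f(z)=\langle f,K^\omega_z\rangle_{L^2(\omega)}$. Let $\nu$ be a positive finite Borel measure on $\mathbb D$. The Toeplitz operator $T_\nu$ is given, on the dense linear span of the kernels $K^\omega_a$ ($a\in\mathbb D$), by $$T_\nu f(z)=\int_{\mathbb D}f(\lambda)\overline{K^\omega_z(\lambda)}\,d\nu(\lambda)\qquad(z\in\mathbb D);$$ it is called compact on $L^2_h(\omega)$ if these integrals converge absolutely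 and the operator extends to a compact operator on $L^2_h(\omega)$. Write $D(z,r)=\{\lambda\in\mathbb D:|\frac{\lambda-z}{1-\bar z\lambda}|<r\}$ and $$R_z(\lambda)=\frac1{(1-\bar\lambda z)^2}+\frac1{(1-\bar z\lambda)^2}-1,\qquad \widetilde\nu(z)=\frac{1}{\|R_z\|^2_{L^2(\omega)}}\int_{\mathbb D}|R_z(\lambda)|^2\,d\nu(\lambda).$$ Then the following conditions are equivalent: (1) $T_\nu$ is compact on $L^2_h(\omega)$; (2) $\nu$ is a vanishing Carleson measure for $L^2_h(\omega)$, i.e. for some $r\in(0,1)$, $\displaystyle\lim_{|z|\to1^-}\frac{\nu(D(z,r))}{|D(z,r)|_\omega}=0$; (3) $\displaystyle\lim_{|z|\to1^-}\widetilde\nu(z)=0$. -/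

import Mathlib

open MeasureTheory Filter Topology Metric
open scoped ENNReal ComplexConjugate

namespace HarmonicBergman

noncomputable section

/-- The open unit disk. -/
abbrev disk : Set ℂ := ball (0 : ℂ) 1

/-- Lebesgue area measure on the unit disk, normalized so that the disk has measure one. -/
def area : Measure ℂ := (ENNReal.ofReal Real.pi)⁻¹ • (volume.restrict disk)

/-- The measure `ω dA` on the unit disk; `weighted ω E` is `|E|_ω`. -/
def weighted (ω : ℂ → ℝ) : Measure ℂ := area.withDensity (fun z => ENNReal.ofReal (ω z))

/-- The Muckenhoupt `A₂` characteristic of `ω`: the supremum, over the centres `a` in the disk and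
the radii `0 < r < 1`, of `|B|_ω |B|_{1/ω} / |B|²` with `B = {z in the disk : |z - a| < r}`.
(The measures involved do not charge the complement of the disk.) -/
def a2Characteristic (ω : ℂ → ℝ) : ℝ≥0∞ :=
  ⨆ a ∈ disk, ⨆ r ∈ Set.Ioo (0 : ℝ) 1,
    weighted ω (ball a r) * weighted (fun z => (ω z)⁻¹) (ball a r) / area (ball a r) ^ 2

/-- Muckenhoupt `A₂` weights on the unit disk. -/
structure IsA2Weight (ω : ℂ → ℝ) : Prop where
  pos : ∀ᵐ z ∂area, 0 < ω z
  integrable : Integrable ω area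
  a2 : a2Characteristic ω < ∞

/-- The pseudohyperbolic disk `D(a, r)`. -/
def pseudoDisk (a : ℂ) (r : ℝ) : Set ℂ :=
  {z ∈ disk | ‖(z - a) / (1 - conj a * z)‖ < r}

/-- The weighted harmonic Bergman space `L²_h(ω)`: the elements of `L²(ω dA)` that are given by a
complex-valued harmonic function on the disk. It carries the inner product of `L²(ω dA)`. -/
def bergman (ω : ℂ → ℝ) : Submodule ℂ (Lp ℂ 2 (weighted ω)) where
  carrier := {f | ∃ g : ℂ → ℂ,
    InnerProductSpace.HarmonicOnNhd g disk ∧ (f : ℂ → ℂ) =ᵐ[weighted ω] g}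
  add_mem' := by
    rintro f₁ f₂ ⟨g₁, h₁, e₁⟩ ⟨g₂, h₂, e₂⟩
    exact ⟨g₁ + g₂, h₁.add h₂, (Lp.coeFn_add f₁ f₂).trans (e₁.add e₂)⟩
  zero_mem' := ⟨0, fun z _ => InnerProductSpace.harmonicAt_const 0, Lp.coeFn_zero ℂ 2 _⟩
  smul_mem' := by
    rintro c f ⟨g, h, e⟩
    refine ⟨fun z => c * g z, ?_, ?_⟩
    · exact h.comp_CLM (((ContinuousLinearMap.mul ℂ ℂ) c).restrictScalars ℝ)
    · filter_upwards [Lp.coeFn_smul c f, e] with z h₁ h₂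
      simp [h₁, h₂]

/-- A harmonic function on the disk representing an element of `L²_h(ω)` (two such functions agree
on the disk when `ω` is positive almost everywhere there). -/
def rep {ω : ℂ → ℝ} (f : bergman ω) : ℂ → ℂ := f.2.choose

theorem harmonicOnNhd_rep {ω : ℂ → ℝ} (f : bergman ω) :
    InnerProductSpace.HarmonicOnNhd (rep f) disk := f.2.choose_spec.1

theorem coe_ae_eq_rep {ω : ℂ → ℝ} (f : bergman ω) :
    ((f : Lp ℂ 2 (weighted ω)) : ℂ → ℂ) =ᵐ[weighted ω] rep f := f.2.choose_spec.2

open Classical in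
/-- The reproducing kernel `K^ω_z` of `L²_h(ω)`: the element with `f(z) = ⟨f, K^ω_z⟩` for every
`f` in `L²_h(ω)`. (Mathlib's inner product is conjugate-linear in its first argument. At most one
such element exists, and one does for `A₂` weights and `z` in the disk.) -/
def kernel (ω : ℂ → ℝ) (z : ℂ) : bergman ω :=
  if h : ∃ k : bergman ω, ∀ f : bergman ω, rep f z = inner ℂ k f then h.choose else 0

/-- `T_ν f = g`: for every `z` in the disk the integral `∫ f(λ) conj(K^ω_z(λ)) dν(λ)` converges
absolutely and equals `g(z)`. -/
def IsToeplitzImage (ω : ℂ → ℝ) (ν : Measure ℂ) (f g : bergman ω) : Prop :=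
  ∀ z ∈ disk, Integrable (fun w => rep f w * conj (rep (kernel ω z) w)) ν ∧
    rep g z = ∫ w, rep f w * conj (rep (kernel ω z) w) ∂ν

/-- `T_ν` is compact on `L²_h(ω)`: the operator given by the integral formula on the linear span of
the reproducing kernels (a dense subspace) extends to a compact operator on `L²_h(ω)`. -/
def IsCompactToeplitz (ω : ℂ → ℝ) (ν : Measure ℂ) : Prop :=
  ∃ T : bergman ω →L[ℂ] bergman ω, IsCompactOperator T ∧
    ∀ f ∈ Submodule.span ℂ (kernel ω '' disk), IsToeplitzImage ω ν f (T f)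

/-- The filter `|z| → 1⁻`. -/
def toBoundary : Filter ℂ := comap (fun z : ℂ => ‖z‖) (𝓝[<] 1)

/-- `ν` is a vanishing Carleson measure for `L²_h(ω)`. -/
def IsVanishingCarleson (ω : ℂ → ℝ) (ν : Measure ℂ) : Prop :=
  ∃ r ∈ Set.Ioo (0 : ℝ) 1,
    Tendsto (fun z => ν (pseudoDisk z r) / weighted ω (pseudoDisk z r)) toBoundary (𝓝 0)

/-- The reproducing kernel `R_z(w)` of the unweighted harmonic Bergman space. -/
def unweightedKernel (z w : ℂ) : ℂ :=
  1 / (1 - conj w * z) ^ 2 + 1 / (1 - conj z * w) ^ 2 - 1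

/-- The Berezin transform of `ν`: `‖R_z‖⁻² ∫ |R_z|² dν`, with the norm of `L²(ω dA)`. -/
def berezin (ω : ℂ → ℝ) (ν : Measure ℂ) (z : ℂ) : ℝ≥0∞ :=
  (∫⁻ w, ‖unweightedKernel z w‖ₑ ^ 2 ∂ν) / ∫⁻ w, ‖unweightedKernel z w‖ₑ ^ 2 ∂(weighted ω)

end

end HarmonicBergman

/-!
Write `W = ω dA`, `S = ω⁻¹ dA`, `δ = 1 - |z|`, and `D(z, r)` for the pseudohyperbolic disk. For an
`A₂` weight, the Cauchy–Schwarz inequality `|E|² ≤ W(E) S(E)` and the `A₂` inequality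
`W(B) S(B) ≤ C |B|²` together show that both measures are doubling (`A2Pair.mul_sq_le`), and that a
harmonic function satisfies `|f(z)|² ≤ C W(B)⁻¹ ∫_B |f|² dW` for every disk `B` about `z`
(`enorm_sq_mul_weighted_le`). Hence norm convergence in `L²_h(ω)` implies locally uniform
convergence, the space is complete, the kernels `K_z` exist, span a dense subspace and depend
continuously on `z`.

Compactness implies the Berezin condition. If `T` extends `T_ν`, then `⟨f, T f⟩ = ∫ |f|² dν` on the
span of the kernels, so `∫ |f|² dν ≤ |⟨f, T f⟩|` for every `f`, by Fatou's lemma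
(`lintegral_rep_sq_le`). The normalized functions `R_z / ‖R_z‖` tend weakly to zero at the
boundary, since `|R_z(a)| ≤ 6 (1 - |a|)⁻²` while `‖R_z‖` tends to infinity
(`tendsto_lintegral_unweightedKernel`); a compact operator makes the quadratic form on a weakly null
bounded family tend to zero (`eventually_norm_inner_le_of_compact`).

The Berezin condition implies the Carleson condition. On `D(z, 1/8)` the kernel is at least of order
`δ⁻²`, so `δ⁻⁴ ν(D(z, 1/8))` is bounded by a multiple of `∫ |R_z|² dν`. What has to be shown is the
converse estimate `‖R_z‖² ≤ K δ⁻⁴ W(D(z, 1/8))`. Splitting the integral over the dyadic disks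
`B_k` of radius `2ᵏ δ / 8`, the `k`-th annulus contributes at most a multiple of `1 / S(B_k)`.
Doubling alone would only bound the sum up to a logarithm, but `S` also satisfies a reverse doubling
inequality (`A2Pair.reverse_doubling`), so these terms decay geometrically from `1 / S(B_0)`
(`A2Pair.setLIntegral_dyadic_le`, `exists_lintegral_unweightedKernel_le`).

The Carleson condition implies compactness. Integrating the pointwise estimate of `|f|²` against `ν`
and interchanging the integrals bounds `∫_{|z| > ρ} |f|² dν` by `ε(ρ) ‖f‖²` with `ε(ρ) → 0`
(`exists_lintegral_compl_le`). The operator-norm integrals of the rank-one operators `K_z ⊗ K_z`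
over the disks `|z| ≤ ρ` are compact, and by this estimate they converge in norm to an extension of
`T_ν` (`exists_isCompactOperator_of_form`).
-/

namespace HarmonicBergman

open InnerProductSpace

/-! ### The area measure -/

instance : IsProbabilityMeasure area := by
  constructor
  have h : ENNReal.ofReal Real.pi ≠ 0 := by simp [Real.pi_pos]
  simp only [area, Measure.smul_apply, Measure.restrict_apply_univ, smul_eq_mul, Complex.volume_ball]
  simp only [ENNReal.ofReal_one, one_pow, one_mul]
  rw [← ENNReal.ofReal_coe_nnreal, NNReal.coe_real_pi]
  exact ENNReal.inv_mul_cancel h ENNReal.ofReal_ne_top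

theorem area_apply_of_subset {E : Set ℂ} (h : E ⊆ disk) :
    area E = (ENNReal.ofReal Real.pi)⁻¹ * volume E := by
  rw [area, Measure.smul_apply, Measure.restrict_eq_self _ h, smul_eq_mul]

theorem area_compl_disk : area diskᶜ = 0 := by
  simp [area, Measure.restrict_apply isOpen_ball.measurableSet.compl]

theorem area_real_ball_of_subset {c : ℂ} {r : ℝ} (hr : 0 ≤ r) (h : ball c r ⊆ disk) :
    area.real (ball c r) = r ^ 2 := by
  rw [Measure.real, area_apply_of_subset h, Complex.volume_ball, ENNReal.toReal_mul,
    ENNReal.toReal_mul]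
  simp only [ENNReal.toReal_inv, ENNReal.toReal_pow, ENNReal.toReal_ofReal hr,
    ENNReal.toReal_ofReal Real.pi_pos.le, ENNReal.coe_toReal, NNReal.coe_real_pi]
  field_simp

theorem area_real_ball_le {c : ℂ} {r : ℝ} (hr : 0 ≤ r) : area.real (ball c r) ≤ r ^ 2 := by
  have h : area (ball c r) ≤ (ENNReal.ofReal Real.pi)⁻¹ * volume (ball c r) := by
    rw [area, Measure.smul_apply, smul_eq_mul]
    gcongr
    exact Measure.restrict_le_self
  refine (ENNReal.toReal_mono ?_ h).trans_eq ?_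
  · exact ENNReal.mul_ne_top (by simp [Real.pi_pos]) measure_ball_lt_top.ne
  · rw [Complex.volume_ball, ENNReal.toReal_mul, ENNReal.toReal_mul]
    simp only [ENNReal.toReal_inv, ENNReal.toReal_pow, ENNReal.toReal_ofReal hr,
      ENNReal.toReal_ofReal Real.pi_pos.le, ENNReal.coe_toReal, NNReal.coe_real_pi]
    field_simp

theorem le_area_real_ball {a : ℂ} (ha : a ∈ disk) {R : ℝ} (hR : 0 < R) (hR2 : R ≤ 2) :
    R ^ 2 / 4 ≤ area.real (ball a R) := by
  have ha' : ‖a‖ < 1 := by simpa using ha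
  -- the disk of radius `R / 2` obtained by moving the centre towards the origin
  have hc : ‖((1 - R / 2 : ℝ) : ℂ) * a‖ = (1 - R / 2) * ‖a‖ := by
    rw [norm_mul, Complex.norm_real, Real.norm_of_nonneg (by linarith)]
  have hd : ‖((1 - R / 2 : ℝ) : ℂ) * a - a‖ = R / 2 * ‖a‖ := by
    rw [show ((1 - R / 2 : ℝ) : ℂ) * a - a = ((-(R / 2) : ℝ) : ℂ) * a by push_cast; ring, norm_mul,
      Complex.norm_real, norm_neg, Real.norm_of_nonneg (by linarith)]
  rw [show R ^ 2 / 4 = (R / 2) ^ 2 by ring, ← area_real_ball_of_subset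
    (c := ((1 - R / 2 : ℝ) : ℂ) * a) (r := R / 2) (by linarith)]
  · refine measureReal_mono (ball_subset_ball' ?_)
    rw [dist_eq_norm, hd]
    nlinarith
  · refine ball_subset_ball' ?_
    rw [dist_eq_norm, sub_zero, hc]
    nlinarith

/-! ### Muckenhoupt weights -/

/-- The consequences of the `A₂` condition used below, for the measures `W = ω dA` and
`S = ω⁻¹ dA`: the Cauchy–Schwarz inequality and the `A₂` inequality with constant `C`, the latter
for disks of every positive radius; and finiteness and absolute continuity of both measures. The two
measures play symmetric roles. -/
structure A2Pair (W S : Measure ℂ) (C : ℝ) : Prop where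
  sq_le : ∀ E, MeasurableSet E → area.real E ^ 2 ≤ W.real E * S.real E
  le_sq : ∀ a ∈ disk, ∀ R, 0 < R →
    W.real (ball a R) * S.real (ball a R) ≤ C * area.real (ball a R) ^ 2
  finite_left : IsFiniteMeasure W
  finite_right : IsFiniteMeasure S
  ac_left : W ≪ area
  ac_right : S ≪ area

namespace A2Pair

variable {W S : Measure ℂ} {C : ℝ}

theorem symm (h : A2Pair W S C) : A2Pair S W C :=
  ⟨fun E hE => mul_comm (W.real E) _ ▸ h.sq_le E hE,
   fun a ha R hR => mul_comm (W.real (ball a R)) _ ▸ h.le_sq a ha R hR,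
   h.finite_right, h.finite_left, h.ac_right, h.ac_left⟩

theorem measure_compl_disk (h : A2Pair W S C) : W diskᶜ = 0 := h.ac_left area_compl_disk

theorem pos_of_area_pos (h : A2Pair W S C) {E : Set ℂ} (hE : MeasurableSet E)
    (h0 : 0 < area.real E) : 0 < W.real E := by
  have h1 := h.sq_le E hE
  by_contra h2
  have h3 : W.real E = 0 := le_antisymm (not_lt.1 h2) measureReal_nonneg
  rw [h3, zero_mul] at h1
  nlinarith

theorem real_ball_pos (h : A2Pair W S C) {a : ℂ} (ha : a ∈ disk) {R : ℝ} (hR : 0 < R) :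
    0 < W.real (ball a R) := by
  have := h.finite_left
  have h1 : 0 < area.real (ball a (min R 2)) :=
    lt_of_lt_of_le (by positivity) (le_area_real_ball ha (lt_min hR two_pos) (min_le_right _ _))
  exact (h.pos_of_area_pos measurableSet_ball h1).trans_le
    (measureReal_mono (ball_subset_ball (min_le_left _ _)))

theorem one_le (h : A2Pair W S C) : 1 ≤ C := by
  have h0 : (0 : ℂ) ∈ disk := by simp
  have h1 := (h.sq_le _ measurableSet_ball).trans (h.le_sq 0 h0 1 one_pos)
  rw [area_real_ball_of_subset zero_le_one subset_rfl] at h1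
  linarith

/-- A subset of a disk carries at least the fraction `C⁻¹ (|E| / |B|)²` of its weighted measure. -/
theorem mul_sq_le (h : A2Pair W S C) {a : ℂ} (ha : a ∈ disk) {R : ℝ} (hR : 0 < R) {E : Set ℂ}
    (hE : MeasurableSet E) (hEB : E ⊆ ball a R) :
    W.real (ball a R) * area.real E ^ 2 ≤ C * area.real (ball a R) ^ 2 * W.real E := by
  have := h.finite_right
  have h1 := h.sq_le E hE
  have h2 : S.real E ≤ S.real (ball a R) := measureReal_mono hEB
  have h3 := h.le_sq a ha R hR
  have h4 : (0 : ℝ) ≤ W.real E := measureReal_nonneg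
  have h5 : (0 : ℝ) ≤ W.real (ball a R) := measureReal_nonneg
  calc W.real (ball a R) * area.real E ^ 2
      ≤ W.real (ball a R) * (W.real E * S.real E) := by gcongr
    _ ≤ W.real (ball a R) * (W.real E * S.real (ball a R)) := by gcongr
    _ = W.real (ball a R) * S.real (ball a R) * W.real E := by ring
    _ ≤ _ := by gcongr

/-- Reverse doubling: doubling the radius increases the weighted measure by a definite factor,
because the larger disk contains a disk of comparable radius outside the smaller one. -/
theorem reverse_doubling (h : A2Pair W S C) {a : ℂ} (ha : a ∈ disk) {R : ℝ} (hR : 0 < R)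
    (hR2 : R ≤ 1 / 2) :
    W.real (ball a R) ≤ (1 - 1 / (256 * C)) * W.real (ball a (2 * R)) := by
  have := h.finite_left
  have hC := h.one_le
  have ha' : ‖a‖ < 1 := by simpa using ha
  obtain ⟨u, hu, hau⟩ : ∃ u : ℂ, ‖u‖ = 1 ∧ a = ‖a‖ * u := by
    by_cases h0 : a = 0
    · exact ⟨1, by simp, by simp [h0]⟩
    · have : (‖a‖ : ℂ) ≠ 0 := by simpa using h0
      refine ⟨a / ‖a‖, ?_, by field_simp⟩
      rw [norm_div, Complex.norm_real, norm_norm, div_self (by simpa using h0)]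
  set c : ℂ := a - (3 / 2 * R : ℝ) * u with hc
  have hca : dist c a = 3 / 2 * R := by
    rw [dist_eq_norm, hc, sub_sub_cancel_left, norm_neg, norm_mul, hu, Complex.norm_real,
      Real.norm_of_nonneg (by positivity), mul_one]
  have hc0 : ‖c‖ = |‖a‖ - 3 / 2 * R| := by
    rw [show c = ((‖a‖ - 3 / 2 * R : ℝ) : ℂ) * u by
      rw [hc]; nth_rw 1 [hau]; push_cast; ring, norm_mul, hu, Complex.norm_real, mul_one,
      Real.norm_eq_abs]
  have hsub : ball c (R / 2) ⊆ disk := by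
    refine ball_subset_ball' ?_
    rw [dist_eq_norm, sub_zero, hc0]
    have := norm_nonneg a
    rcases abs_cases (‖a‖ - 3 / 2 * R) with h | h <;> linarith
  have hsub2 : ball c (R / 2) ⊆ ball a (2 * R) := ball_subset_ball' (by rw [hca]; linarith)
  have hdis : Disjoint (ball a R) (ball c (R / 2)) :=
    ball_disjoint_ball (by rw [dist_comm, hca]; linarith)
  have h1 := h.mul_sq_le ha (R := 2 * R) (by positivity) measurableSet_ball hsub2
  rw [area_real_ball_of_subset (by positivity) hsub] at h1
  have h2 : area.real (ball a (2 * R)) ^ 2 ≤ ((2 * R) ^ 2) ^ 2 := by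
    gcongr; exact area_real_ball_le (by positivity)
  have h3 : W.real (ball a R) + W.real (ball c (R / 2)) ≤ W.real (ball a (2 * R)) := by
    rw [← measureReal_union hdis measurableSet_ball]
    exact measureReal_mono (Set.union_subset (ball_subset_ball (by linarith)) hsub2)
  have h5 : (0 : ℝ) ≤ W.real (ball c (R / 2)) := measureReal_nonneg
  have h4 : W.real (ball a (2 * R)) * (1 / (256 * C)) ≤ W.real (ball c (R / 2)) := by
    rw [mul_one_div, div_le_iff₀ (by positivity)]
    have h6 : W.real (ball a (2 * R)) * R ^ 4 ≤ W.real (ball c (R / 2)) * (256 * C) * R ^ 4 := by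
      have : C * area.real (ball a (2 * R)) ^ 2 * W.real (ball c (R / 2)) ≤
        C * ((2 * R) ^ 2) ^ 2 * W.real (ball c (R / 2)) := by gcongr
      linarith
    exact le_of_mul_le_mul_right h6 (by positivity)
  linarith

end A2Pair

theorem weighted_apply_univ_ne_top {ω : ℂ → ℝ} (hω : IsA2Weight ω) :
    weighted ω Set.univ ≠ ∞ := by
  rw [weighted, withDensity_apply _ MeasurableSet.univ, setLIntegral_univ]
  exact hω.integrable.lintegral_lt_top.ne

theorem weighted_absolutelyContinuous (ω : ℂ → ℝ) : weighted ω ≪ area :=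
  withDensity_absolutelyContinuous _ _

/-- The Cauchy–Schwarz inequality for `F = (F √ω) (√ω)⁻¹`. -/
theorem setLIntegral_area_sq_le {ω : ℂ → ℝ} (hω : IsA2Weight ω) {E : Set ℂ}
    (hE : MeasurableSet E) {F : ℂ → ℝ≥0∞} (hF : AEMeasurable F (area.restrict E)) :
    (∫⁻ z in E, F z ∂area) ^ 2 ≤
      (∫⁻ z in E, F z ^ 2 ∂(weighted ω)) * weighted (fun z => (ω z)⁻¹) E := by
  have hm : AEMeasurable ω (area.restrict E) := hω.integrable.aemeasurable.restrict
  have h := ENNReal.lintegral_mul_le_Lp_mul_Lq (area.restrict E) Real.HolderConjugate.two_two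
    (f := fun z => F z * ENNReal.ofReal (√(ω z))) (g := fun z => ENNReal.ofReal (√(ω z)⁻¹))
    (hF.mul hm.sqrt.ennreal_ofReal) (hm.inv.sqrt.ennreal_ofReal)
  have hsq : ∀ x : ℝ, ENNReal.ofReal √x ^ (2 : ℝ) = ENNReal.ofReal x := by
    intro x
    rw [ENNReal.rpow_two, ← ENNReal.ofReal_pow (Real.sqrt_nonneg _)]
    rcases le_total 0 x with hx | hx
    · rw [Real.sq_sqrt hx]
    · rw [Real.sqrt_eq_zero_of_nonpos hx, ENNReal.ofReal_of_nonpos hx]; simp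
  have hone : ∫⁻ z in E, ((fun z => F z * ENNReal.ofReal (√(ω z))) * fun z =>
      ENNReal.ofReal (√(ω z)⁻¹)) z ∂area = ∫⁻ z in E, F z ∂area := by
    refine lintegral_congr_ae (ae_restrict_of_ae ?_)
    filter_upwards [hω.pos] with z hz
    simp only [Pi.mul_apply]
    rw [mul_assoc, ← ENNReal.ofReal_mul (Real.sqrt_nonneg _), ← Real.sqrt_mul hz.le,
      mul_inv_cancel₀ hz.ne']
    simp
  rw [hone] at h
  simp only [ENNReal.mul_rpow_of_nonneg _ _ zero_le_two, hsq] at h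
  have hW : ∫⁻ z in E, F z ^ 2 ∂(weighted ω) =
      ∫⁻ z in E, F z ^ (2 : ℝ) * ENNReal.ofReal (ω z) ∂area := by
    rw [weighted, restrict_withDensity hE,
      lintegral_withDensity_eq_lintegral_mul₀ hm.ennreal_ofReal (hF.pow_const 2)]
    refine lintegral_congr fun z => ?_
    rw [Pi.mul_apply, mul_comm, ENNReal.rpow_two]
  rw [← hW, ← withDensity_apply (fun z => ENNReal.ofReal (ω z)⁻¹) hE] at h
  refine (pow_le_pow_left' h 2).trans_eq ?_
  rw [mul_pow, ← ENNReal.rpow_two, ← ENNReal.rpow_two, ← ENNReal.rpow_mul, ← ENNReal.rpow_mul]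
  norm_num
  rfl

theorem area_sq_le_weighted_mul {ω : ℂ → ℝ} (hω : IsA2Weight ω) (E : Set ℂ)
    (hE : MeasurableSet E) :
    area E ^ 2 ≤ weighted ω E * weighted (fun z => (ω z)⁻¹) E := by
  have h := setLIntegral_area_sq_le hω hE (F := fun _ => 1) aemeasurable_const
  simpa using h

theorem area_ball_ne_zero {a : ℂ} (ha : a ∈ disk) {R : ℝ} (hR : 0 < R) : area (ball a R) ≠ 0 := by
  have h1 : 0 < area.real (ball a (min R 2)) :=
    lt_of_lt_of_le (by positivity) (le_area_real_ball ha (lt_min hR two_pos) (min_le_right _ _))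
  have h2 := (ENNReal.toReal_pos_iff.1 h1).1
  exact (h2.trans_le (measure_mono (ball_subset_ball (min_le_left _ _)))).ne'

theorem weighted_mul_le {ω : ℂ → ℝ} {a : ℂ} (ha : a ∈ disk) {r : ℝ}
    (hr : r ∈ Set.Ioo (0 : ℝ) 1) :
    weighted ω (ball a r) * weighted (fun z => (ω z)⁻¹) (ball a r) ≤
      a2Characteristic ω * area (ball a r) ^ 2 := by
  have h : weighted ω (ball a r) * weighted (fun z => (ω z)⁻¹) (ball a r) / area (ball a r) ^ 2
      ≤ a2Characteristic ω := by
    unfold a2Characteristic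
    exact le_iSup₂_of_le a ha (le_iSup₂_of_le r hr le_rfl)
  rwa [ENNReal.div_le_iff (pow_ne_zero _ (area_ball_ne_zero ha hr.1)) (by finiteness)] at h

theorem weighted_mul_univ_le {ω : ℂ → ℝ} (hω : IsA2Weight ω) :
    weighted ω Set.univ * weighted (fun z => (ω z)⁻¹) Set.univ ≤ a2Characteristic ω := by
  have hU : ∀ μ : Measure ℂ, μ ≪ area → Tendsto (fun n : ℕ => μ (ball 0 (1 - 1 / ((n : ℝ) + 2))))
      atTop (𝓝 (μ Set.univ)) := by
    intro μ hμ
    have h1 : μ Set.univ = μ (⋃ n : ℕ, ball 0 (1 - 1 / ((n : ℝ) + 2))) := by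
      refine measure_congr (ae_eq_set.2 ⟨?_, by simp⟩)
      refine measure_mono_null ?_ (hμ area_compl_disk)
      intro z hz
      simp only [Set.mem_sdiff, Set.mem_univ, Set.mem_iUnion, true_and, not_exists, mem_ball,
        dist_zero_right, not_lt, Set.mem_compl_iff] at hz ⊢
      refine le_of_tendsto' (f := fun n : ℕ => 1 - 1 / ((n : ℝ) + 2)) (x := atTop) ?_ hz
      have := (tendsto_const_div_atTop_nhds_zero_nat (1 : ℝ)).comp (tendsto_add_atTop_nat 2)
      simpa [Function.comp_def] using this.const_sub 1
    rw [h1]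
    refine tendsto_measure_iUnion_atTop ?_
    intro m n hmn
    refine ball_subset_ball ?_
    have : (m : ℝ) ≤ n := by exact_mod_cast hmn
    gcongr
  have h1 := area_sq_le_weighted_mul hω Set.univ MeasurableSet.univ
  rw [measure_univ, one_pow] at h1
  have hW : weighted ω Set.univ ≠ 0 := by rintro h; simp [h] at h1
  refine le_of_tendsto' (ENNReal.Tendsto.mul (hU _ (weighted_absolutelyContinuous _)) (Or.inl hW)
    (hU _ (weighted_absolutelyContinuous _)) (Or.inr (weighted_apply_univ_ne_top hω))) ?_
  intro n
  have h2 : (0 : ℝ) < 1 / ((n : ℝ) + 2) := by positivity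
  have h3 : 1 / ((n : ℝ) + 2) < 1 := by
    rw [div_lt_one (by positivity)]
    have : (0 : ℝ) ≤ n := n.cast_nonneg
    linarith
  refine (weighted_mul_le (by simp) ⟨by linarith, by linarith⟩).trans ?_
  exact mul_le_of_le_one_right' (pow_le_one' prob_le_one _)

/-- For an `A₂` weight, the `A₂` inequality extends to all disks with centre in the unit disk: a
disk of radius at least one occupies a fixed fraction of the area of the unit disk. -/
theorem IsA2Weight.exists_a2Pair {ω : ℂ → ℝ} (hω : IsA2Weight ω) :
    ∃ C, A2Pair (weighted ω) (weighted fun z => (ω z)⁻¹) C := by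
  have h1 := area_sq_le_weighted_mul hω Set.univ MeasurableSet.univ
  rw [measure_univ, one_pow] at h1
  have hW : weighted ω Set.univ ≠ 0 := by rintro h; simp [h] at h1
  have h2 := weighted_mul_univ_le hω
  have hS : weighted (fun z => (ω z)⁻¹) Set.univ ≠ ∞ := by
    intro h
    rw [h, ENNReal.mul_top hW] at h2
    exact absurd (h2.trans_lt hω.a2) (by simp)
  have fW : IsFiniteMeasure (weighted ω) := ⟨(weighted_apply_univ_ne_top hω).lt_top⟩
  have fS : IsFiniteMeasure (weighted fun z => (ω z)⁻¹) := ⟨hS.lt_top⟩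
  have hC := hω.a2.ne
  refine ⟨16 * (a2Characteristic ω).toReal, ?_, ?_, fW, fS, weighted_absolutelyContinuous _,
    weighted_absolutelyContinuous _⟩
  · intro E hE
    have := ENNReal.toReal_mono (by finiteness) (area_sq_le_weighted_mul hω E hE)
    simpa [Measure.real] using this
  · intro a ha R hR
    rcases lt_or_ge R 1 with h | h
    · have := ENNReal.toReal_mono (by finiteness) (weighted_mul_le (ω := ω) ha ⟨hR, h⟩)
      simp only [ENNReal.toReal_mul, ENNReal.toReal_pow] at this
      refine this.trans ?_
      have h3 : 0 ≤ (a2Characteristic ω).toReal := ENNReal.toReal_nonneg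
      simp only [Measure.real]
      gcongr
      linarith
    · have h3 : 0 ≤ (a2Characteristic ω).toReal := ENNReal.toReal_nonneg
      have h4 : 1 / 4 ≤ area.real (ball a R) := by
        have := le_area_real_ball ha one_pos one_le_two
        rw [one_pow] at this
        exact this.trans (measureReal_mono (ball_subset_ball h))
      have h5 := ENNReal.toReal_mono hC h2
      rw [ENNReal.toReal_mul] at h5
      calc (weighted ω).real (ball a R) * (weighted fun z => (ω z)⁻¹).real (ball a R)
          ≤ (weighted ω).real Set.univ * (weighted fun z => (ω z)⁻¹).real Set.univ := by
            exact mul_le_mul (measureReal_mono (Set.subset_univ _))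
              (measureReal_mono (Set.subset_univ _)) measureReal_nonneg measureReal_nonneg
        _ ≤ (a2Characteristic ω).toReal := h5
        _ = 16 * (a2Characteristic ω).toReal * (1 / 4) ^ 2 := by ring
        _ ≤ _ := by gcongr

/-! ### Harmonic functions -/

section Harmonic

open Real
theorem norm_circleAverage_le {f : ℂ → ℂ} {c : ℂ} {R M : ℝ} (hR : 0 ≤ R)
    (h : ∀ z ∈ sphere c R, ‖f z‖ ≤ M) : ‖circleAverage f c R‖ ≤ M := by
  have h1 : ‖∫ θ in (0 : ℝ)..2 * π, f (circleMap c R θ)‖ ≤ M * |2 * π - 0| :=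
    intervalIntegral.norm_integral_le_of_norm_le_const fun θ _ => h _ (circleMap_mem_sphere c hR θ)
  rw [circleAverage, norm_smul, norm_inv, Real.norm_of_nonneg (by positivity),
    inv_mul_le_iff₀ (by positivity)]
  rwa [sub_zero, abs_of_pos (by positivity), mul_comm M] at h1

theorem sub_ne_zero_of_mem_sphere {R : ℝ} {w z : ℂ} (hw : w ∈ ball (0 : ℂ) R)
    (hz : z ∈ sphere (0 : ℂ) R) : z - w ≠ 0 := by
  intro h
  rw [sub_eq_zero.1 h] at hz
  simp at hz hw
  linarith

theorem continuousOn_herglotzRieszKernel {R : ℝ} {w : ℂ} (hw : w ∈ ball (0 : ℂ) R) :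
    ContinuousOn (herglotzRieszKernel 0 w) (sphere 0 R) := by
  rw [herglotzRieszKernel_fun_def]
  simp only [sub_zero]
  exact ContinuousOn.div (by fun_prop) (by fun_prop) fun z hz => sub_ne_zero_of_mem_sphere hw hz

/-- The Poisson integral formula for complex-valued harmonic functions. -/
theorem circleAverage_herglotzRieszKernel_re_mul {f : ℂ → ℂ} {R : ℝ} {w : ℂ}
    (hf : HarmonicOnNhd f (closedBall 0 R)) (hw : w ∈ ball (0 : ℂ) R) :
    circleAverage (fun z => ((herglotzRieszKernel 0 w z).re : ℂ) * f z) 0 R = f w := by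
  have hR : 0 ≤ R := (pos_of_mem_ball hw).le
  have hfc : ContinuousOn f (sphere 0 R) := hf.contDiffOn.continuousOn.mono sphere_subset_closedBall
  have hI : CircleIntegrable (fun z => ((herglotzRieszKernel 0 w z).re : ℂ) * f z) 0 R := by
    refine ContinuousOn.circleIntegrable hR (ContinuousOn.mul ?_ hfc)
    exact (Complex.continuous_ofReal.comp Complex.continuous_re).comp_continuousOn
      (continuousOn_herglotzRieszKernel hw)
  apply Complex.ext
  · have h1 := HarmonicOnNhd.circleAverage_re_herglotzRieszKernel_smul
      (hf.comp_CLM Complex.reCLM) hw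
    have h2 := Complex.reCLM.circleAverage_comp_comm hI
    rw [Complex.reCLM_apply] at h2
    rw [← h2]
    simp only [Function.comp_apply, Complex.reCLM_apply] at h1
    rw [← h1]
    congr 1
    ext z
    simp
  · have h1 := HarmonicOnNhd.circleAverage_re_herglotzRieszKernel_smul
      (hf.comp_CLM Complex.imCLM) hw
    have h2 := Complex.imCLM.circleAverage_comp_comm hI
    rw [Complex.imCLM_apply] at h2
    rw [← h2]
    simp only [Function.comp_apply, Complex.imCLM_apply] at h1
    rw [← h1]
    congr 1
    ext z
    simp

theorem norm_sub_ge_of_mem_sphere {R ρ : ℝ} {w z : ℂ} (hw : ‖w‖ ≤ ρ)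
    (hz : z ∈ sphere (0 : ℂ) R) : R - ρ ≤ ‖z - w‖ := by
  have := norm_sub_norm_le z w
  simp at hz
  linarith

/-- Harmonic functions satisfy a Lipschitz estimate on smaller disks. -/
theorem norm_sub_le_of_harmonic {f : ℂ → ℂ} {R ρ M : ℝ} (hρ : ρ < R)
    (hf : HarmonicOnNhd f (closedBall 0 R)) (hM : ∀ z ∈ sphere (0 : ℂ) R, ‖f z‖ ≤ M) {w v : ℂ}
    (hw : ‖w‖ ≤ ρ) (hv : ‖v‖ ≤ ρ) :
    ‖f w - f v‖ ≤ 2 * R / (R - ρ) ^ 2 * ‖w - v‖ * M := by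
  have hwR : w ∈ ball (0 : ℂ) R := by simp; linarith
  have hvR : v ∈ ball (0 : ℂ) R := by simp; linarith
  have hR : 0 ≤ R := (pos_of_mem_ball hwR).le
  have hfc : ContinuousOn f (sphere 0 R) := hf.contDiffOn.continuousOn.mono sphere_subset_closedBall
  have hI : ∀ u ∈ ball (0 : ℂ) R,
      CircleIntegrable (fun z => ((herglotzRieszKernel 0 u z).re : ℂ) * f z) 0 R := fun u hu => by
    refine ContinuousOn.circleIntegrable hR (ContinuousOn.mul ?_ hfc)
    exact (Complex.continuous_ofReal.comp Complex.continuous_re).comp_continuousOn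
      (continuousOn_herglotzRieszKernel hu)
  rw [← circleAverage_herglotzRieszKernel_re_mul hf hwR,
    ← circleAverage_herglotzRieszKernel_re_mul hf hvR,
    ← circleAverage_fun_sub (hI w hwR) (hI v hvR)]
  refine norm_circleAverage_le hR fun z hz => ?_
  rw [← sub_mul, norm_mul, ← Complex.ofReal_sub, ← Complex.sub_re]
  have h1 : ‖((herglotzRieszKernel 0 w z - herglotzRieszKernel 0 v z).re : ℂ)‖ ≤
      2 * R / (R - ρ) ^ 2 * ‖w - v‖ := by
    rw [Complex.norm_real, Real.norm_eq_abs]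
    refine (Complex.abs_re_le_norm _).trans ?_
    have hw0 := sub_ne_zero_of_mem_sphere hwR hz
    have hv0 := sub_ne_zero_of_mem_sphere hvR hz
    have h2 : herglotzRieszKernel 0 w z - herglotzRieszKernel 0 v z =
        2 * z * (w - v) / ((z - w) * (z - v)) := by
      rw [herglotzRieszKernel_def, herglotzRieszKernel_def]
      simp only [sub_zero]
      field_simp
      ring
    have hzR : ‖z‖ = R := by simpa using hz
    rw [h2, norm_div, norm_mul, norm_mul, norm_mul, hzR, Complex.norm_ofNat,
      div_mul_eq_mul_div]
    have h3 := norm_sub_ge_of_mem_sphere hw hz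
    have h4 := norm_sub_ge_of_mem_sphere hv hz
    have h5 : 0 < R - ρ := by linarith
    gcongr
    nlinarith
  gcongr
  exact hM z hz

/-- The Herglotz–Riesz integral of a function on a circle is holomorphic in the disk: up to a
constant it is twice the Cauchy integral. -/
theorem analyticAt_circleAverage_herglotzRieszKernel {f : ℂ → ℂ} {R : ℝ}
    (hf : ContinuousOn f (sphere 0 R)) {w : ℂ} (hw : w ∈ ball (0 : ℂ) R) :
    AnalyticAt ℂ (fun w => circleAverage (fun z => herglotzRieszKernel 0 w z * f z) 0 R) w := by
  have hR : 0 < R := pos_of_mem_ball hw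
  lift R to NNReal using hR.le
  have hA := (hasFPowerSeriesOn_cauchy_integral (hf.circleIntegrable hR.le)
    (by exact_mod_cast hR)).analyticOnNhd w (by simpa [Metric.eball_coe] using hw)
  have hB : AnalyticAt ℂ (fun w => 2 * ((2 * π * Complex.I : ℂ)⁻¹ •
      ∮ z in C(0, R), (z - w)⁻¹ • f z) - circleAverage f 0 R) w :=
    (analyticAt_const.mul hA).sub analyticAt_const
  refine hB.congr ?_
  filter_upwards [isOpen_ball.mem_nhds hw] with v hv
  have hc : ContinuousOn (fun z => (z - v)⁻¹) (sphere (0 : ℂ) R) :=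
    ContinuousOn.inv₀ (by fun_prop) fun z hz => sub_ne_zero_of_mem_sphere hv hz
  have h0 : ∀ z ∈ sphere (0 : ℂ) R, z ≠ 0 := by
    rintro z hz rfl
    simp at hz
    exact hR.ne (by exact_mod_cast hz)
  have h1 : ((2 * π * Complex.I : ℂ)⁻¹ • ∮ z in C(0, R), (z - v)⁻¹ • f z) =
      circleAverage (fun z => z * (z - v)⁻¹ * f z) 0 R := by
    rw [circleAverage_eq_circleIntegral hR.ne']
    congr 1
    refine circleIntegral.integral_congr hR.le fun z hz => ?_
    have := h0 z hz
    simp only [sub_zero, smul_eq_mul]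
    field_simp
  have hI : CircleIntegrable (fun z => z * (z - v)⁻¹ * f z) 0 R :=
    ((continuousOn_id.mul hc).mul hf).circleIntegrable hR.le
  rw [h1, ← smul_eq_mul, ← circleAverage_fun_smul, ← circleAverage_fun_sub
    (by exact CircleIntegrable.const_smul hI) (hf.circleIntegrable hR.le)]
  refine circleAverage_congr_sphere fun z hz => ?_
  rw [abs_of_pos hR] at hz
  have := sub_ne_zero_of_mem_sphere hv hz
  rw [herglotzRieszKernel_def]
  simp only [sub_zero, smul_eq_mul]
  field_simp
  ring

/-- The Poisson integral of a continuous function is harmonic. -/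
theorem harmonicAt_circleAverage_herglotzRieszKernel_re {f : ℂ → ℂ} {R : ℝ}
    (hf : ContinuousOn f (sphere 0 R)) {w : ℂ} (hw : w ∈ ball (0 : ℂ) R) :
    HarmonicAt (fun w =>
      circleAverage (fun z => ((herglotzRieszKernel 0 w z).re : ℂ) * f z) 0 R) w := by
  have hR : 0 < R := pos_of_mem_ball hw
  have hf' : ContinuousOn (fun z => conj (f z)) (sphere 0 R) :=
    Complex.continuous_conj.comp_continuousOn hf
  have h1 := (analyticAt_circleAverage_herglotzRieszKernel hf hw).harmonicAt
  have h2 := (analyticAt_circleAverage_herglotzRieszKernel hf' hw).harmonicAt_conj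
  refine (harmonicAt_congr_nhds ?_).1 ((h1.add h2).const_smul (c := (1 / 2 : ℝ)))
  filter_upwards [isOpen_ball.mem_nhds hw] with v hv
  have hI1 : CircleIntegrable (fun z => herglotzRieszKernel 0 v z * f z) 0 R :=
    ((continuousOn_herglotzRieszKernel hv).mul hf).circleIntegrable hR.le
  have hI2 : CircleIntegrable (fun z => herglotzRieszKernel 0 v z * conj (f z)) 0 R :=
    ((continuousOn_herglotzRieszKernel hv).mul hf').circleIntegrable hR.le
  have hI3 : CircleIntegrable (fun z => conj (herglotzRieszKernel 0 v z) * f z) 0 R :=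
    ((Complex.continuous_conj.comp_continuousOn
      (continuousOn_herglotzRieszKernel hv)).mul hf).circleIntegrable hR.le
  have h3 := (Complex.conjCLE : ℂ →L[ℝ] ℂ).circleAverage_comp_comm hI2
  simp only [Function.comp_def, ContinuousLinearEquiv.coe_coe, Complex.conjCLE_apply, map_mul,
    Complex.conj_conj] at h3
  simp only [Pi.smul_apply, Pi.add_apply]
  rw [Pi.conj_apply, ← h3, ← circleAverage_fun_add hI1 hI3, ← circleAverage_fun_smul]
  congr 1
  ext z
  rw [← add_mul, Complex.add_conj, Complex.real_smul]
  push_cast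
  ring

/-- A uniform limit of harmonic functions is harmonic, by passing to the limit in the Poisson
integral formula. -/
theorem harmonicOnNhd_of_tendstoUniformlyOn {F : ℕ → ℂ → ℂ} {f : ℂ → ℂ} {R : ℝ} (hR : 0 < R)
    (hF : ∀ n, HarmonicOnNhd (F n) (closedBall 0 R))
    (h : TendstoUniformlyOn F f atTop (closedBall 0 R)) : HarmonicOnNhd f (ball 0 R) := by
  have hFc : ∀ n, ContinuousOn (F n) (closedBall 0 R) := fun n => (hF n).contDiffOn.continuousOn
  have hfc : ContinuousOn f (sphere 0 R) :=
    (h.continuousOn (Frequently.of_forall hFc)).mono sphere_subset_closedBall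
  intro w hw
  refine (harmonicAt_congr_nhds ?_).1 (harmonicAt_circleAverage_herglotzRieszKernel_re hfc hw)
  filter_upwards [isOpen_ball.mem_nhds hw] with v hv
  have hP : ContinuousOn (fun z => ((herglotzRieszKernel 0 v z).re : ℂ)) (sphere 0 R) :=
    (Complex.continuous_ofReal.comp Complex.continuous_re).comp_continuousOn
      (continuousOn_herglotzRieszKernel hv)
  obtain ⟨M, hM⟩ := (isCompact_sphere (0 : ℂ) R).exists_bound_of_continuousOn hP
  have h1 : Tendsto (fun n => F n v) atTop (𝓝 (f v)) := h.tendsto_at (ball_subset_closedBall hv)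
  refine tendsto_nhds_unique ?_ h1
  rw [Metric.tendsto_atTop]
  intro ε hε
  have hM' : 0 < |M| + 1 := by positivity
  obtain ⟨N, hN⟩ := eventually_atTop.1 (Metric.tendstoUniformlyOn_iff.1 h (ε / (2 * (|M| + 1)))
    (by positivity))
  refine ⟨N, fun n hn => ?_⟩
  have hI1 : CircleIntegrable (fun z => ((herglotzRieszKernel 0 v z).re : ℂ) * F n z) 0 R :=
    (hP.mul ((hFc n).mono sphere_subset_closedBall)).circleIntegrable hR.le
  have hI2 : CircleIntegrable (fun z => ((herglotzRieszKernel 0 v z).re : ℂ) * f z) 0 R :=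
    (hP.mul hfc).circleIntegrable hR.le
  rw [dist_eq_norm, ← circleAverage_herglotzRieszKernel_re_mul (hF n) hv,
    ← circleAverage_fun_sub hI1 hI2]
  refine (norm_circleAverage_le (M := ε / 2) hR.le fun z hz => ?_).trans_lt (half_lt_self hε)
  rw [← mul_sub, norm_mul, ← dist_eq_norm, dist_comm]
  calc _ ≤ (|M| + 1) * (ε / (2 * (|M| + 1))) := by
        gcongr
        · exact (hM z hz).trans ((le_abs_self M).trans (by linarith))
        · exact (hN n hn z (sphere_subset_closedBall hz)).le
    _ = ε / 2 := by field_simp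

/-- The sub-mean value inequality over disks. It follows from the one over circles by averaging
over rotations, which preserve the area. -/
theorem enorm_mul_volume_le_lintegral {f : ℂ → ℂ} {z : ℂ} {R : ℝ}
    (hf : HarmonicOnNhd f (ball z R)) :
    ‖f z‖ₑ * volume (ball z R) ≤ ∫⁻ w in ball z R, ‖f w‖ₑ := by
  classical
  set g : ℂ → ℝ≥0∞ := (ball z R).indicator fun w => ‖f w‖ₑ with hg
  have hgm : Measurable g := by
    have hc : ContinuousOn (fun w => ‖f w‖ₑ) (ball z R) := hf.contDiffOn.continuousOn.enorm
    have := hc.measurable_piecewise (continuousOn_const (c := (0 : ℝ≥0∞)))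
      (measurableSet_ball (x := z) (ε := R))
    rw [hg, ← Set.piecewise_eq_indicator]
    exact this
  have hcircle : ∀ w ∈ ball (0 : ℂ) R, ENNReal.ofReal (2 * π) * ‖f z‖ₑ ≤
      ∫⁻ θ in Set.Ioc 0 (2 * π), g (z + rotation (Circle.exp θ) w) := by
    intro w hw
    have hw' : ‖w‖ < R := by simpa using hw
    have hmap : ∀ θ : ℝ, circleMap z ‖w‖ (θ + Complex.arg w) = z + rotation (Circle.exp θ) w := by
      intro θ
      rw [circleMap, rotation_apply, Circle.coe_exp]
      conv_rhs => rw [← Complex.norm_mul_exp_arg_mul_I w]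
      push_cast
      rw [add_mul, Complex.exp_add]
      ring
    have hmem : ∀ θ : ℝ, z + rotation (Circle.exp θ) w ∈ ball z R := by
      intro θ
      simpa [dist_eq_norm] using hw'
    have h1 : circleAverage f z ‖w‖ = f z := by
      refine InnerProductSpace.HarmonicOnNhd.circleAverage_eq (hf.mono ?_)
      rw [abs_norm]
      exact closedBall_subset_ball hw'
    rw [circleAverage_eq_integral_add (Complex.arg w)] at h1
    have h2 : ‖∫ θ in (0 : ℝ)..2 * π, f (circleMap z ‖w‖ (θ + Complex.arg w))‖ₑ ≤
        ∫⁻ θ in Set.Ioc 0 (2 * π), g (z + rotation (Circle.exp θ) w) := by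
      rw [intervalIntegral.integral_of_le (by positivity)]
      refine (enorm_integral_le_lintegral_enorm _).trans_eq ?_
      refine lintegral_congr fun θ => ?_
      rw [hmap, hg, Set.indicator_of_mem (hmem θ)]
    refine le_trans (le_of_eq ?_) h2
    rw [← h1, enorm_smul, ← mul_assoc, Real.enorm_of_nonneg (by positivity),
      ← ENNReal.ofReal_mul (by positivity), mul_inv_cancel₀ (by positivity)]
    simp
  have hrot : ∀ θ : ℝ, ∫⁻ w in ball (0 : ℂ) R, g (z + rotation (Circle.exp θ) w) ≤
      ∫⁻ w in ball z R, ‖f w‖ₑ := by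
    intro θ
    rw [← lintegral_indicator measurableSet_ball (fun w => ‖f w‖ₑ)]
    refine (setLIntegral_le_lintegral _ _).trans_eq ?_
    rw [← lintegral_add_left_eq_self g z]
    exact (rotation (Circle.exp θ)).measurePreserving.lintegral_comp
      (hgm.comp (measurable_const_add z))
  have hjoint : Measurable fun p : ℂ × ℝ => g (z + rotation (Circle.exp p.2) p.1) := by
    refine hgm.comp ?_
    simp only [rotation_apply]
    have : Continuous fun p : ℂ × ℝ => z + (Circle.exp p.2 : ℂ) * p.1 := by fun_prop
    exact this.measurable
  have hmain : ENNReal.ofReal (2 * π) * ‖f z‖ₑ * volume (ball (0 : ℂ) R) ≤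
      ENNReal.ofReal (2 * π) * ∫⁻ w in ball z R, ‖f w‖ₑ := by
    calc _ = ∫⁻ w in ball (0 : ℂ) R, ENNReal.ofReal (2 * π) * ‖f z‖ₑ := by
          rw [setLIntegral_const]
      _ ≤ ∫⁻ w in ball (0 : ℂ) R, ∫⁻ θ in Set.Ioc 0 (2 * π),
          g (z + rotation (Circle.exp θ) w) := setLIntegral_mono' measurableSet_ball hcircle
      _ = ∫⁻ θ in Set.Ioc 0 (2 * π), ∫⁻ w in ball (0 : ℂ) R,
          g (z + rotation (Circle.exp θ) w) := lintegral_lintegral_swap hjoint.aemeasurable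
      _ ≤ ∫⁻ θ in Set.Ioc 0 (2 * π), ∫⁻ w in ball z R, ‖f w‖ₑ := lintegral_mono hrot
      _ = _ := by
          rw [setLIntegral_const, Real.volume_Ioc, sub_zero, mul_comm]
  rw [mul_assoc, ENNReal.mul_le_mul_iff_right (by simp [pi_pos]) ENNReal.ofReal_ne_top] at hmain
  rwa [Complex.volume_ball] at hmain ⊢

end Harmonic

/-! ### The weighted harmonic Bergman space -/

theorem A2Pair.le_sq_enorm {W S : Measure ℂ} {C : ℝ} (h : A2Pair W S C) {a : ℂ} (ha : a ∈ disk)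
    {R : ℝ} (hR : 0 < R) :
    W (ball a R) * S (ball a R) ≤ ENNReal.ofReal C * area (ball a R) ^ 2 := by
  have := h.finite_left
  have := h.finite_right
  have hC := h.one_le
  have h1 := ENNReal.ofReal_le_ofReal (h.le_sq a ha R hR)
  rw [ENNReal.ofReal_mul measureReal_nonneg, ENNReal.ofReal_mul (by linarith),
    ENNReal.ofReal_pow measureReal_nonneg] at h1
  simpa using h1

theorem A2Pair.real_univ_mul_le {W S : Measure ℂ} {C : ℝ} (h : A2Pair W S C) {a : ℂ}
    (ha : a ∈ disk) {R : ℝ} (hR : 0 < R) (hR2 : R ≤ 2) :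
    W.real Set.univ * (R ^ 2 / 4) ^ 2 ≤ C * W.real (ball a R) := by
  have hC := h.one_le
  have hd : disk ⊆ ball a 2 := by
    refine ball_subset_ball' ?_
    have : dist a 0 < 1 := ha
    rw [dist_comm]
    linarith
  have h1 := h.mul_sq_le ha two_pos (measurableSet_ball (x := a) (ε := R)) (ball_subset_ball hR2)
  have h2 : W.real (ball a 2) = W.real Set.univ := by
    refine measureReal_congr (ae_eq_univ.2 (measure_mono_null ?_ h.measure_compl_disk))
    exact Set.compl_subset_compl.2 hd
  rw [h2] at h1
  have h3 : area.real (ball a 2) ^ 2 ≤ 1 := pow_le_one₀ measureReal_nonneg measureReal_le_one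
  have h4 := le_area_real_ball ha hR hR2
  calc W.real Set.univ * (R ^ 2 / 4) ^ 2 ≤ W.real Set.univ * area.real (ball a R) ^ 2 := by
        gcongr
    _ ≤ _ := h1
    _ ≤ C * 1 * W.real (ball a R) := by gcongr
    _ = _ := by ring

/-- The value of a harmonic function at `z` is controlled by its weighted mean square over a disk
centred at `z`, by the mean value property, the Cauchy–Schwarz inequality and the `A₂` condition. -/
theorem enorm_sq_mul_weighted_le {ω : ℂ → ℝ} (hω : IsA2Weight ω) {C : ℝ}
    (hC : A2Pair (weighted ω) (weighted fun z => (ω z)⁻¹) C) {g : ℂ → ℂ} {z : ℂ} {R : ℝ}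
    (hR : 0 < R) (hz : ball z R ⊆ disk) (hg : HarmonicOnNhd g (ball z R)) :
    ‖g z‖ₑ ^ 2 * weighted ω (ball z R) ≤
      ENNReal.ofReal C * ∫⁻ w in ball z R, ‖g w‖ₑ ^ 2 ∂(weighted ω) := by
  have hzd : z ∈ disk := hz (mem_ball_self hR)
  have hres : area.restrict (ball z R) =
      (ENNReal.ofReal Real.pi)⁻¹ • volume.restrict (ball z R) := by
    rw [area, Measure.restrict_smul, Measure.restrict_restrict measurableSet_ball,
      Set.inter_eq_self_of_subset_left hz]
  have hgc : ContinuousOn g (ball z R) := hg.contDiffOn.continuousOn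
  have hgm : AEMeasurable (fun w => ‖g w‖ₑ) (area.restrict (ball z R)) := by
    rw [hres]
    exact ((hgc.aestronglyMeasurable measurableSet_ball).enorm).smul_measure _
  have h1 : ‖g z‖ₑ * area (ball z R) ≤ ∫⁻ w in ball z R, ‖g w‖ₑ ∂area := by
    rw [hres, lintegral_smul_measure, area_apply_of_subset hz, smul_eq_mul, mul_left_comm]
    gcongr
    exact enorm_mul_volume_le_lintegral hg
  have h2 := (pow_le_pow_left' h1 2).trans (setLIntegral_area_sq_le hω measurableSet_ball hgm)
  have hA0 : area (ball z R) ^ 2 ≠ 0 := pow_ne_zero _ (area_ball_ne_zero hzd hR)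
  have hA1 : area (ball z R) ^ 2 ≠ ∞ := by finiteness
  rw [← ENNReal.mul_le_mul_iff_left hA0 hA1]
  calc ‖g z‖ₑ ^ 2 * weighted ω (ball z R) * area (ball z R) ^ 2
      = (‖g z‖ₑ * area (ball z R)) ^ 2 * weighted ω (ball z R) := by ring
    _ ≤ (∫⁻ w in ball z R, ‖g w‖ₑ ^ 2 ∂(weighted ω)) * weighted (fun z => (ω z)⁻¹) (ball z R) *
        weighted ω (ball z R) := by gcongr
    _ = (∫⁻ w in ball z R, ‖g w‖ₑ ^ 2 ∂(weighted ω)) *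
        (weighted ω (ball z R) * weighted (fun z => (ω z)⁻¹) (ball z R)) := by ring
    _ ≤ (∫⁻ w in ball z R, ‖g w‖ₑ ^ 2 ∂(weighted ω)) *
        (ENNReal.ofReal C * area (ball z R) ^ 2) := by
        exact mul_le_mul' le_rfl (hC.le_sq_enorm hzd hR)
    _ = _ := by ring

theorem lintegral_enorm_sq_eq {μ : Measure ℂ} (f : Lp ℂ 2 μ) {g : ℂ → ℂ}
    (h : (f : ℂ → ℂ) =ᵐ[μ] g) : ∫⁻ w, ‖g w‖ₑ ^ 2 ∂μ = ‖f‖ₑ ^ 2 := by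
  rw [Lp.enorm_def, eLpNorm_eq_lintegral_rpow_enorm_toReal two_ne_zero ENNReal.ofNat_ne_top]
  simp only [ENNReal.toReal_ofNat, ENNReal.rpow_two]
  rw [← ENNReal.rpow_two, ← ENNReal.rpow_mul]
  norm_num
  refine lintegral_congr_ae ?_
  filter_upwards [h] with w hw
  rw [hw]

theorem closedBall_subset_disk {ρ : ℝ} (hρ : ρ < 1) : closedBall (0 : ℂ) ρ ⊆ disk :=
  closedBall_subset_ball hρ

/-- On compact subsets of the disk, point evaluations of harmonic functions are uniformly bounded
with respect to the norm of `L²(ω dA)`. -/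
theorem exists_norm_le_mul_norm {ω : ℂ → ℝ} (hω : IsA2Weight ω) {ρ : ℝ} (hρ0 : 0 ≤ ρ)
    (hρ : ρ < 1) :
    ∃ M, 0 ≤ M ∧ ∀ (f : Lp ℂ 2 (weighted ω)) (g : ℂ → ℂ), HarmonicOnNhd g disk →
      (f : ℂ → ℂ) =ᵐ[weighted ω] g → ∀ z ∈ closedBall (0 : ℂ) ρ, ‖g z‖ ≤ M * ‖f‖ := by
  obtain ⟨C, hC⟩ := hω.exists_a2Pair
  have := hC.finite_left
  have hC1 := hC.one_le
  set m : ℝ := (weighted ω).real Set.univ * ((1 - ρ) ^ 2 / 4) ^ 2 / C with hm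
  have h0 : (0 : ℝ) < (weighted ω).real Set.univ :=
    (hC.real_ball_pos (mem_ball_self one_pos) one_pos).trans_le
      (measureReal_mono (Set.subset_univ _))
  have hm0 : 0 < m := by
    have : 0 < 1 - ρ := by linarith
    positivity
  refine ⟨√(C / m), by positivity, fun f g hg hfg z hz => ?_⟩
  have hz' : ‖z‖ ≤ ρ := by simpa using hz
  have hzd : z ∈ disk := closedBall_subset_disk hρ hz
  have hsub : ball z (1 - ρ) ⊆ disk := by
    refine ball_subset_ball' ?_
    rw [dist_zero_right]
    linarith
  have h1 := enorm_sq_mul_weighted_le hω hC (by linarith) hsub (hg.mono hsub)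
  have h2 : ∫⁻ w in ball z (1 - ρ), ‖g w‖ₑ ^ 2 ∂(weighted ω) ≤ ‖f‖ₑ ^ 2 :=
    (setLIntegral_le_lintegral _ _).trans_eq (lintegral_enorm_sq_eq f hfg)
  have h3 := ENNReal.toReal_mono (by finiteness) (h1.trans (mul_le_mul_right h2 _))
  simp only [ENNReal.toReal_mul, ENNReal.toReal_pow, toReal_enorm,
    ENNReal.toReal_ofReal (zero_le_one.trans hC1)] at h3
  have h4 : m ≤ (weighted ω).real (ball z (1 - ρ)) := by
    rw [hm, div_le_iff₀ (by linarith), mul_comm _ C]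
    exact hC.real_univ_mul_le hzd (by linarith) (by linarith)
  refine le_of_sq_le_sq ?_ (by positivity)
  rw [mul_pow, Real.sq_sqrt (by positivity), div_mul_eq_mul_div, le_div_iff₀ hm0]
  exact le_trans (mul_le_mul_of_nonneg_left h4 (sq_nonneg _)) h3

theorem exists_mem_closedBall {z : ℂ} (hz : z ∈ disk) : ∃ ρ, 0 < ρ ∧ ρ < 1 ∧ z ∈ ball (0 : ℂ) ρ := by
  have hz' : ‖z‖ < 1 := by simpa using hz
  exact ⟨(‖z‖ + 1) / 2, by positivity, by linarith, by simp; linarith⟩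

theorem eqOn_of_ae_eq {ω : ℂ → ℝ} (hω : IsA2Weight ω) {g₁ g₂ : ℂ → ℂ}
    (h₁ : HarmonicOnNhd g₁ disk) (h₂ : HarmonicOnNhd g₂ disk) (h : g₁ =ᵐ[weighted ω] g₂) :
    Set.EqOn g₁ g₂ disk := by
  intro z hz
  obtain ⟨ρ, hρ0, hρ1, hzρ⟩ := exists_mem_closedBall hz
  obtain ⟨M, -, hM⟩ := exists_norm_le_mul_norm hω hρ0.le hρ1
  have h0 := hM 0 (g₁ - g₂) (h₁.sub h₂) ?_ z (ball_subset_closedBall hzρ)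
  · simpa [sub_eq_zero] using h0
  · filter_upwards [Lp.coeFn_zero ℂ 2 (weighted ω), h] with w hw1 hw2
    rw [hw1, Pi.zero_apply, Pi.sub_apply, hw2, sub_self]

theorem rep_eqOn {ω : ℂ → ℝ} (hω : IsA2Weight ω) (f : bergman ω) {g : ℂ → ℂ}
    (hg : HarmonicOnNhd g disk)
    (h : ((f : Lp ℂ 2 (weighted ω)) : ℂ → ℂ) =ᵐ[weighted ω] g) : Set.EqOn (rep f) g disk :=
  eqOn_of_ae_eq hω (harmonicOnNhd_rep f) hg ((coe_ae_eq_rep f).symm.trans h)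

theorem rep_add {ω : ℂ → ℝ} (hω : IsA2Weight ω) (f g : bergman ω) {z : ℂ} (hz : z ∈ disk) :
    rep (f + g) z = rep f z + rep g z := by
  refine rep_eqOn hω (f + g) ((harmonicOnNhd_rep f).add (harmonicOnNhd_rep g)) ?_ hz
  exact (Lp.coeFn_add _ _).trans ((coe_ae_eq_rep f).add (coe_ae_eq_rep g))

theorem rep_smul {ω : ℂ → ℝ} (hω : IsA2Weight ω) (c : ℂ) (f : bergman ω) {z : ℂ}
    (hz : z ∈ disk) : rep (c • f) z = c * rep f z := by
  refine rep_eqOn hω (c • f) (g := fun w => c * rep f w) ?_ ?_ hz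
  · exact (harmonicOnNhd_rep f).comp_CLM (((ContinuousLinearMap.mul ℂ ℂ) c).restrictScalars ℝ)
  · filter_upwards [Lp.coeFn_smul c (f : Lp ℂ 2 (weighted ω)), coe_ae_eq_rep f] with w h₁ h₂
    simp [h₁, h₂]

theorem exists_norm_rep_le {ω : ℂ → ℝ} (hω : IsA2Weight ω) {ρ : ℝ} (hρ0 : 0 ≤ ρ) (hρ : ρ < 1) :
    ∃ M, 0 ≤ M ∧ ∀ (f : bergman ω), ∀ z ∈ closedBall (0 : ℂ) ρ, ‖rep f z‖ ≤ M * ‖f‖ := by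
  obtain ⟨M, hM0, hM⟩ := exists_norm_le_mul_norm hω hρ0 hρ
  exact ⟨M, hM0, fun f z hz => hM f _ (harmonicOnNhd_rep f) (coe_ae_eq_rep f) z hz⟩

/-- The weighted harmonic Bergman space is closed in `L²(ω dA)`: convergence in norm implies locally
uniform convergence in the disk. -/
theorem isClosed_bergman {ω : ℂ → ℝ} (hω : IsA2Weight ω) :
    IsClosed (bergman ω : Set (Lp ℂ 2 (weighted ω))) := by
  refine IsSeqClosed.isClosed fun F f hF hFf => ?_
  choose G hG hFG using hF
  have hcauchy : ∀ ρ, 0 < ρ → ρ < 1 → UniformCauchySeqOn G atTop (closedBall 0 ρ) := by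
    intro ρ hρ0 hρ
    obtain ⟨M, hM0, hM⟩ := exists_norm_le_mul_norm hω hρ0.le hρ
    rw [Metric.uniformCauchySeqOn_iff]
    intro ε hε
    obtain ⟨N, hN⟩ := Metric.cauchySeq_iff.1 hFf.cauchySeq (ε / (M + 1)) (by positivity)
    refine ⟨N, fun m hm n hn z hz => ?_⟩
    have h1 := hM (F m - F n) (G m - G n) ((hG m).sub (hG n))
      ((Lp.coeFn_sub _ _).trans ((hFG m).sub (hFG n))) z hz
    have h2 := hN m hm n hn
    rw [dist_eq_norm] at h2 ⊢
    refine h1.trans_lt ?_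
    calc M * ‖F m - F n‖ ≤ (M + 1) * ‖F m - F n‖ := by gcongr; linarith
      _ < (M + 1) * (ε / (M + 1)) := by gcongr
      _ = ε := by field_simp
  have hlim : ∀ z ∈ disk, Tendsto (fun n => G n z) atTop (𝓝 (limUnder atTop fun n => G n z)) := by
    intro z hz
    obtain ⟨ρ, hρ0, hρ1, hzρ⟩ := exists_mem_closedBall hz
    exact ((hcauchy ρ hρ0 hρ1).cauchySeq (ball_subset_closedBall hzρ)).tendsto_limUnder
  refine ⟨fun z => limUnder atTop fun n => G n z, ?_, ?_⟩
  · intro z hz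
    obtain ⟨ρ, hρ0, hρ1, hzρ⟩ := exists_mem_closedBall hz
    refine harmonicOnNhd_of_tendstoUniformlyOn hρ0
      (fun n => (hG n).mono (closedBall_subset_disk hρ1)) ?_ z hzρ
    exact (hcauchy ρ hρ0 hρ1).tendstoUniformlyOn_of_tendsto
      fun w hw => hlim w (closedBall_subset_disk hρ1 hw)
  · obtain ⟨ns, hns, hae⟩ := (tendstoInMeasure_of_tendsto_Lp hFf).exists_seq_tendsto_ae
    have hd : ∀ᵐ z ∂(weighted ω), z ∈ disk :=
      (weighted_absolutelyContinuous ω).ae_le (ae_iff.2 area_compl_disk)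
    filter_upwards [hae, hd, ae_all_iff.2 hFG] with z h1 h2 h3
    refine tendsto_nhds_unique h1 ?_
    simp only [h3]
    exact (hlim z h2).comp hns.tendsto_atTop

theorem completeSpace_bergman {ω : ℂ → ℝ} (hω : IsA2Weight ω) : CompleteSpace (bergman ω) :=
  (isClosed_bergman hω).completeSpace_coe

/-- The reproducing property of the kernel. -/
theorem rep_eq_inner_kernel {ω : ℂ → ℝ} (hω : IsA2Weight ω) {z : ℂ} (hz : z ∈ disk)
    (f : bergman ω) : rep f z = inner ℂ (kernel ω z) f := by
  have hex : ∃ k : bergman ω, ∀ f : bergman ω, rep f z = inner ℂ k f := by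
    have := completeSpace_bergman hω
    obtain ⟨ρ, hρ0, hρ1, hzρ⟩ := exists_mem_closedBall hz
    obtain ⟨M, hM0, hM⟩ := exists_norm_rep_le hω hρ0.le hρ1
    let ev : bergman ω →L[ℂ] ℂ := LinearMap.mkContinuous
      { toFun := fun f => rep f z
        map_add' := fun f g => rep_add hω f g hz
        map_smul' := fun c f => rep_smul hω c f hz } M
      fun f => hM f z (ball_subset_closedBall hzρ)
    refine ⟨(InnerProductSpace.toDual ℂ (bergman ω)).symm ev, fun f => ?_⟩
    rw [InnerProductSpace.toDual_symm_apply]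
    rfl
  rw [kernel, dif_pos hex]
  exact hex.choose_spec f

theorem dense_span_kernel {ω : ℂ → ℝ} (hω : IsA2Weight ω) :
    Dense (Submodule.span ℂ (kernel ω '' disk) : Set (bergman ω)) := by
  have := completeSpace_bergman hω
  rw [Submodule.dense_iff_topologicalClosure_eq_top, Submodule.topologicalClosure_eq_top_iff,
    Submodule.eq_bot_iff]
  intro f hf
  have h0 : ∀ z ∈ disk, rep f z = 0 := fun z hz => by
    rw [rep_eq_inner_kernel hω hz]
    exact (Submodule.mem_orthogonal _ _).1 hf _ (Submodule.subset_span ⟨z, hz, rfl⟩)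
  have hd : ∀ᵐ z ∂(weighted ω), z ∈ disk :=
    (weighted_absolutelyContinuous ω).ae_le (ae_iff.2 area_compl_disk)
  refine Subtype.ext (Lp.ext ?_)
  filter_upwards [coe_ae_eq_rep f, hd, Lp.coeFn_zero ℂ 2 (weighted ω)] with z h1 h2 h3
  rw [h1, h0 z h2, Submodule.coe_zero, h3, Pi.zero_apply]

theorem norm_sq_eq_norm_inner {ω : ℂ → ℝ} (f : bergman ω) : ‖f‖ ^ 2 = ‖(inner ℂ f f : ℂ)‖ := by
  have h := inner_self_eq_norm_sq_to_K (𝕜 := ℂ) f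
  rw [h]
  simp

theorem continuousOn_kernel {ω : ℂ → ℝ} (hω : IsA2Weight ω) : ContinuousOn (kernel ω) disk := by
  intro z hz
  obtain ⟨ρ, hρ0, hρ1, hzρ⟩ := exists_mem_closedBall hz
  obtain ⟨M, hM0, hM⟩ := exists_norm_rep_le hω (ρ := (ρ + 1) / 2) (by linarith) (by linarith)
  set L : ℝ := 2 * ((ρ + 1) / 2) / ((ρ + 1) / 2 - ρ) ^ 2 * M with hL
  have hlip : ∀ v ∈ ball (0 : ℂ) ρ, ∀ w ∈ ball (0 : ℂ) ρ,
      dist (kernel ω v) (kernel ω w) ≤ L * dist v w := by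
    intro v hv w hw
    have hvd : v ∈ disk := ball_subset_ball hρ1.le hv
    have hwd : w ∈ disk := ball_subset_ball hρ1.le hw
    set f := kernel ω v - kernel ω w with hf
    have h1 : rep f v - rep f w = inner ℂ f f := by
      rw [rep_eq_inner_kernel hω hvd, rep_eq_inner_kernel hω hwd]
      exact (inner_sub_left (𝕜 := ℂ) (kernel ω v) (kernel ω w) f).symm
    have h2 := norm_sub_le_of_harmonic (ρ := ρ) (R := (ρ + 1) / 2) (M := M * ‖f‖) (by linarith)
      ((harmonicOnNhd_rep f).mono (closedBall_subset_disk (by linarith)))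
      (fun z hz => hM f z (sphere_subset_closedBall hz)) (mem_ball_zero_iff.1 hv).le
      (mem_ball_zero_iff.1 hw).le
    rw [h1, ← norm_sq_eq_norm_inner f] at h2
    rw [dist_eq_norm, dist_eq_norm, ← hf]
    by_cases h0 : ‖f‖ = 0
    · rw [h0]
      have : 0 < (ρ + 1) / 2 - ρ := by linarith
      positivity
    · refine le_of_mul_le_mul_right (a := ‖f‖) ?_ (lt_of_le_of_ne (norm_nonneg _) (Ne.symm h0))
      rw [hL]
      nlinarith [h2]
  have hc : ContinuousOn (kernel ω) (ball 0 ρ) := by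
    refine (LipschitzOnWith.of_dist_le_mul (K := Real.toNNReal L) fun v hv w hw => ?_).continuousOn
    refine (hlip v hv w hw).trans ?_
    gcongr
    exact Real.le_coe_toNNReal L
  exact (hc.continuousAt (isOpen_ball.mem_nhds hzρ)).continuousWithinAt

theorem aestronglyMeasurable_of_harmonic {μ : Measure ℂ} (hμ : μ diskᶜ = 0) {g : ℂ → ℂ}
    (hg : HarmonicOnNhd g disk) : AEStronglyMeasurable g μ := by
  rw [← Measure.restrict_eq_self_of_ae_mem (ae_iff.2 hμ)]
  exact hg.contDiffOn.continuousOn.aestronglyMeasurable measurableSet_ball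

/-! ### Estimates for the unweighted kernel -/

theorem one_sub_norm_le {z w : ℂ} (hw : ‖w‖ ≤ 1) : 1 - ‖z‖ ≤ ‖1 - conj z * w‖ := by
  have h1 := norm_sub_norm_le 1 (conj z * w)
  rw [norm_one, norm_mul, RCLike.norm_conj] at h1
  nlinarith [norm_nonneg z]

theorem one_sub_norm_le' {z w : ℂ} (hz : ‖z‖ ≤ 1) : 1 - ‖w‖ ≤ ‖1 - conj z * w‖ := by
  have h1 := norm_sub_norm_le 1 (conj z * w)
  rw [norm_one, norm_mul, RCLike.norm_conj] at h1
  nlinarith [norm_nonneg w]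

theorem norm_one_sub_sq (z w : ℂ) :
    ‖1 - conj z * w‖ ^ 2 = ‖w - z‖ ^ 2 + (1 - ‖z‖ ^ 2) * (1 - ‖w‖ ^ 2) := by
  simp only [← Complex.normSq_eq_norm_sq, Complex.normSq_apply, Complex.sub_re, Complex.sub_im,
    Complex.mul_re, Complex.mul_im, Complex.conj_re, Complex.conj_im, Complex.one_re,
    Complex.one_im]
  ring

theorem norm_sub_le_norm_one_sub {z w : ℂ} (hz : ‖z‖ ≤ 1) (hw : ‖w‖ ≤ 1) :
    ‖w - z‖ ≤ ‖1 - conj z * w‖ := by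
  refine le_of_sq_le_sq ?_ (norm_nonneg _)
  rw [norm_one_sub_sq]
  have h1 : 0 ≤ 1 - ‖z‖ ^ 2 := by nlinarith [norm_nonneg z]
  have h2 : 0 ≤ 1 - ‖w‖ ^ 2 := by nlinarith [norm_nonneg w]
  nlinarith [mul_nonneg h1 h2]

theorem one_sub_ne_zero {z w : ℂ} (hz : z ∈ disk) (hw : w ∈ disk) : 1 - conj z * w ≠ 0 := by
  have hz' : ‖z‖ < 1 := by simpa using hz
  have hw' : ‖w‖ < 1 := by simpa using hw
  have := one_sub_norm_le (z := z) hw'.le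
  rw [← norm_pos_iff]
  linarith

theorem unweightedKernel_eq (z w : ℂ) :
    unweightedKernel z w = ((2 * (1 / (1 - conj z * w) ^ 2).re - 1 : ℝ) : ℂ) := by
  have h : 1 / (1 - conj w * z) ^ 2 = conj (1 / (1 - conj z * w) ^ 2) := by
    simp [mul_comm]
  rw [unweightedKernel, h, add_comm, Complex.add_conj]
  push_cast
  ring

theorem norm_unweightedKernel_le {z w : ℂ} (hz : z ∈ disk) (hw : w ∈ disk) :
    ‖unweightedKernel z w‖ ≤ 6 * (‖1 - conj z * w‖ ^ 2)⁻¹ := by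
  have hz' : ‖z‖ < 1 := by simpa using hz
  have hw' : ‖w‖ < 1 := by simpa using hw
  have h0 : 0 < ‖1 - conj z * w‖ := norm_pos_iff.2 (one_sub_ne_zero hz hw)
  have h2 : ‖1 - conj z * w‖ ≤ 2 := by
    refine (norm_sub_le _ _).trans ?_
    rw [norm_one, norm_mul, RCLike.norm_conj]
    nlinarith [norm_nonneg z, norm_nonneg w]
  have h3 : 1 ≤ 4 * (‖1 - conj z * w‖ ^ 2)⁻¹ := by
    rw [← div_eq_mul_inv, one_le_div (by positivity)]
    nlinarith
  have h4 : |(1 / (1 - conj z * w) ^ 2).re| ≤ (‖1 - conj z * w‖ ^ 2)⁻¹ := by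
    refine (Complex.abs_re_le_norm _).trans_eq ?_
    rw [norm_div, norm_one, norm_pow, one_div]
  rw [unweightedKernel_eq, Complex.norm_real, Real.norm_eq_abs]
  rw [abs_le] at h4 ⊢
  constructor <;> linarith [h4.1, h4.2]

theorem norm_unweightedKernel_le_left {z w : ℂ} (hz : z ∈ disk) (hw : w ∈ disk) :
    ‖unweightedKernel z w‖ ≤ 6 * ((1 - ‖z‖) ^ 2)⁻¹ := by
  have hz' : ‖z‖ < 1 := by simpa using hz
  have hw' : ‖w‖ < 1 := by simpa using hw
  refine (norm_unweightedKernel_le hz hw).trans ?_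
  have := one_sub_norm_le (z := z) hw'.le
  have : 0 < 1 - ‖z‖ := by linarith
  gcongr

theorem norm_unweightedKernel_le_right {z w : ℂ} (hz : z ∈ disk) (hw : w ∈ disk) :
    ‖unweightedKernel z w‖ ≤ 6 * ((1 - ‖w‖) ^ 2)⁻¹ := by
  have hz' : ‖z‖ < 1 := by simpa using hz
  have hw' : ‖w‖ < 1 := by simpa using hw
  refine (norm_unweightedKernel_le hz hw).trans ?_
  have := one_sub_norm_le' (w := w) hz'.le
  have : 0 < 1 - ‖w‖ := by linarith
  gcongr

theorem harmonicOnNhd_unweightedKernel {z : ℂ} (hz : z ∈ disk) :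
    HarmonicOnNhd (unweightedKernel z) disk := by
  intro w hw
  have hA : AnalyticAt ℂ (fun w => 1 / (1 - conj z * w) ^ 2) w :=
    analyticAt_const.div ((analyticAt_const.sub (analyticAt_const.mul analyticAt_id)).pow 2)
      (pow_ne_zero _ (one_sub_ne_zero hz hw))
  have hl := (hA.harmonicAt.add hA.harmonicAt_conj).add (harmonicAt_const (-1 : ℂ))
  have : unweightedKernel z = (fun w => 1 / (1 - conj z * w) ^ 2) +
      conj (fun w => 1 / (1 - conj z * w) ^ 2) + fun _ => (-1 : ℂ) := by
    ext w
    simp only [Pi.add_apply, Pi.conj_apply]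
    rw [unweightedKernel_eq, Complex.add_conj]
    push_cast
    ring
  rw [this]
  exact hl

/-- On a small pseudohyperbolic disk about `z` the kernel `R_z` is comparable to `R_z(z)`: with
`ζ = (w - z) / (1 - z̄ w)` one has `(1 - z̄ w)⁻¹ = (1 + z̄ ζ) / (1 - |z|²)`. -/
theorem le_norm_unweightedKernel {z w : ℂ} (hz : z ∈ disk) (hw : w ∈ pseudoDisk z (1 / 8)) :
    (8 * (1 - ‖z‖) ^ 2)⁻¹ ≤ ‖unweightedKernel z w‖ := by
  have hz' : ‖z‖ < 1 := by simpa using hz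
  obtain ⟨hwd, hζ⟩ := hw
  set ζ := (w - z) / (1 - conj z * w) with hζdef
  have hne := one_sub_ne_zero hz hwd
  set d : ℝ := 1 - ‖z‖ ^ 2 with hd
  have hd0 : 0 < d := by rw [hd]; nlinarith [norm_nonneg z]
  have hd1 : d ≤ 1 := by rw [hd]; nlinarith [norm_nonneg z]
  have hd2 : d ≤ 2 * (1 - ‖z‖) := by rw [hd]; nlinarith [norm_nonneg z]
  set u := conj z * ζ with hu
  have hmul : (1 - conj z * w) * (1 + u) = (d : ℂ) := by
    have h1 : ζ * (1 - conj z * w) = w - z := div_mul_cancel₀ _ hne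
    have h2 : conj z * z = (‖z‖ : ℂ) ^ 2 := by rw [mul_comm, Complex.mul_conj']
    rw [hu, hd]
    push_cast
    linear_combination (conj z) * h1 - h2
  have hdc : (d : ℂ) ≠ 0 := by exact_mod_cast hd0.ne'
  have hinv : 1 / (1 - conj z * w) ^ 2 = ((d ^ 2)⁻¹ : ℝ) * (1 + u) ^ 2 := by
    have : (1 + u) = d / (1 - conj z * w) := by rw [← hmul]; field_simp
    rw [this]
    push_cast
    field_simp
  have hun : ‖u‖ ≤ 1 / 8 := by
    rw [hu, norm_mul, RCLike.norm_conj]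
    nlinarith [norm_nonneg z, norm_nonneg ζ]
  have hre : 3 / 4 ≤ ((1 + u) ^ 2).re := by
    have h1 := (Complex.abs_re_le_norm u).trans hun
    have h2 := (Complex.abs_im_le_norm u).trans hun
    rw [abs_le] at h1 h2
    rw [pow_two, Complex.mul_re]
    simp only [Complex.add_re, Complex.one_re, Complex.add_im, Complex.one_im, zero_add]
    nlinarith [h1.1, h1.2, h2.1, h2.2]
  have hi : 1 ≤ (d ^ 2)⁻¹ := (one_le_inv₀ (by positivity)).2 (by nlinarith)
  have hi2 : (8 * (1 - ‖z‖) ^ 2)⁻¹ ≤ 1 / 2 * (d ^ 2)⁻¹ := by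
    rw [show (1 : ℝ) / 2 * (d ^ 2)⁻¹ = (2 * d ^ 2)⁻¹ by rw [mul_inv]; ring]
    refine inv_anti₀ (by positivity) ?_
    nlinarith
  rw [unweightedKernel_eq, Complex.norm_real, Real.norm_eq_abs, hinv, Complex.re_ofReal_mul]
  refine le_trans ?_ (le_abs_self _)
  nlinarith

theorem measurableSet_pseudoDisk (z : ℂ) (r : ℝ) : MeasurableSet (pseudoDisk z r) := by
  have h : MeasurableSet {w : ℂ | ‖(w - z) / (1 - conj z * w)‖ < r} :=
    measurableSet_lt (by fun_prop) measurable_const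
  exact measurableSet_ball.inter h

theorem ball_subset_pseudoDisk {z : ℂ} (hz : z ∈ disk) {s r : ℝ} (hs : s ≤ 1)
    (hsr : s ≤ r) : ball z (s * (1 - ‖z‖)) ⊆ pseudoDisk z r := by
  have hz' : ‖z‖ < 1 := by simpa using hz
  intro w hw
  rw [mem_ball, dist_eq_norm] at hw
  have h1 : ‖w‖ < 1 := by
    have := norm_sub_norm_le w z
    nlinarith
  have h2 := one_sub_norm_le (z := z) h1.le
  refine ⟨by simpa using h1, ?_⟩
  rw [norm_div, div_lt_iff₀ (by linarith)]
  have h3 : 0 < s := by nlinarith [norm_nonneg (w - z)]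
  nlinarith

/-- The lower bound for the mean square of `R_z` with respect to an arbitrary measure. -/
theorem mul_measure_pseudoDisk_le (μ : Measure ℂ) {z : ℂ} (hz : z ∈ disk) :
    ENNReal.ofReal ((64 * (1 - ‖z‖) ^ 4)⁻¹) * μ (pseudoDisk z (1 / 8)) ≤
      ∫⁻ w, ‖unweightedKernel z w‖ₑ ^ 2 ∂μ := by
  have hz' : ‖z‖ < 1 := by simpa using hz
  refine le_trans ?_ (setLIntegral_le_lintegral (pseudoDisk z (1 / 8)) _)
  rw [← setLIntegral_const]
  refine setLIntegral_mono' (measurableSet_pseudoDisk _ _) fun w hw => ?_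
  have h1 := le_norm_unweightedKernel hz hw
  have h2 : 0 < 1 - ‖z‖ := by linarith
  rw [← ofReal_norm, ← ENNReal.ofReal_pow (norm_nonneg _)]
  refine ENNReal.ofReal_le_ofReal ?_
  rw [show (64 * (1 - ‖z‖) ^ 4)⁻¹ = ((8 * (1 - ‖z‖) ^ 2)⁻¹) ^ 2 by rw [inv_pow]; ring_nf]
  gcongr

theorem A2Pair.real_univ_mul_univ_le {W S : Measure ℂ} {C : ℝ} (h : A2Pair W S C) :
    W.real Set.univ * S.real Set.univ ≤ C := by
  have h1 := h.le_sq 0 (by simp) 1 one_pos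
  rw [area_real_ball_of_subset zero_le_one subset_rfl, measureReal_congr
    (ae_eq_univ.2 h.measure_compl_disk), measureReal_congr
    (ae_eq_univ.2 h.symm.measure_compl_disk)] at h1
  simpa using h1

theorem setLIntegral_inv_pow_le {W : Measure ℂ} [IsFiniteMeasure W] (hW : W diskᶜ = 0)
    {E : Set ℂ} {z : ℂ} {R : ℝ} (hR : 0 < R) (hE : MeasurableSet E)
    (h : ∀ w ∈ E, w ∈ disk → R ≤ ‖1 - conj z * w‖) :
    ∫⁻ w in E, ENNReal.ofReal ((‖1 - conj z * w‖ ^ 4)⁻¹) ∂W ≤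
      ENNReal.ofReal ((R ^ 4)⁻¹ * W.real E) := by
  rw [ENNReal.ofReal_mul (by positivity), ofReal_measureReal, ← setLIntegral_const]
  refine lintegral_mono_ae ?_
  filter_upwards [ae_restrict_mem hE, ae_restrict_of_ae (ae_iff.2 hW)] with w h1 h2
  have := h w h1 h2
  refine ENNReal.ofReal_le_ofReal ?_
  gcongr

/-- Dyadic step in the estimate of `∫ |1 - z̄ w|⁻⁴ dW`. The contribution of a dyadic annulus is
controlled by the reciprocal of the `S`-measure of the enclosing disk, by the `A₂` condition. Since
`S` satisfies the reverse doubling inequality, these reciprocals decay geometrically; the inductive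
bound expresses this by the decreasing quantity `∫_{B_k} + M / S(B_k)`. -/
theorem A2Pair.setLIntegral_dyadic_le {W S : Measure ℂ} {C : ℝ} (h : A2Pair W S C) {z : ℂ}
    (hz : z ∈ disk) {δ : ℝ} (hδ : 0 < δ) (hδz : δ ≤ 1 - ‖z‖) (k : ℕ) (hk : 2 ^ k * δ ≤ 1) :
    ∫⁻ w in ball z (2 ^ k * δ), ENNReal.ofReal ((‖1 - conj z * w‖ ^ 4)⁻¹) ∂W ≤
      ENNReal.ofReal ((4096 * C ^ 2 + C) / S.real (ball z δ) -
        4096 * C ^ 2 / S.real (ball z (2 ^ k * δ))) := by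
  have := h.finite_left
  have := h.finite_right
  have hC := h.one_le
  have hz' : ‖z‖ < 1 := by simpa using hz
  have key : ∀ R, 0 < R → W.real (ball z R) ≤ C * R ^ 4 / S.real (ball z R) := by
    intro R hR
    rw [le_div_iff₀ (h.symm.real_ball_pos hz hR)]
    refine (h.le_sq z hz R hR).trans ?_
    rw [show R ^ 4 = (R ^ 2) ^ 2 by ring]
    have := area_real_ball_le (c := z) hR.le
    gcongr
  induction k with
  | zero =>
    simp only [pow_zero, one_mul] at hk ⊢
    refine (setLIntegral_inv_pow_le h.measure_compl_disk hδ measurableSet_ball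
      fun w _ hw => hδz.trans (one_sub_norm_le (mem_ball_zero_iff.1 hw).le)).trans ?_
    refine ENNReal.ofReal_le_ofReal ?_
    rw [← sub_div, add_sub_cancel_left, inv_mul_le_iff₀ (by positivity)]
    refine (key δ hδ).trans_eq ?_
    ring
  | succ k ih =>
    have hp : (2 : ℝ) ^ (k + 1) * δ = 2 * (2 ^ k * δ) := by ring
    rw [hp] at hk ⊢
    set R : ℝ := 2 ^ k * δ with hR
    have hR0 : 0 < R := by positivity
    have hS0 := h.symm.real_ball_pos hz hδ
    have hS1 := h.symm.real_ball_pos hz hR0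
    have hS2 := h.symm.real_ball_pos hz (R := 2 * R) (by positivity)
    have hS01 : S.real (ball z δ) ≤ S.real (ball z R) := by
      refine measureReal_mono (ball_subset_ball ?_)
      rw [hR]
      exact le_mul_of_one_le_left hδ.le (one_le_pow₀ one_le_two)
    have hrev := h.symm.reverse_doubling hz hR0 (by linarith)
    have hsplit : ball z (2 * R) = ball z R ∪ (ball z (2 * R) \ ball z R) :=
      (Set.union_sdiff_cancel (ball_subset_ball (by linarith))).symm
    have h1 := ih (by linarith)
    have h2 : ∫⁻ w in ball z (2 * R) \ ball z R, ENNReal.ofReal ((‖1 - conj z * w‖ ^ 4)⁻¹) ∂W ≤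
        ENNReal.ofReal (16 * C / S.real (ball z (2 * R))) := by
      refine (setLIntegral_inv_pow_le h.measure_compl_disk hR0
        (measurableSet_ball.diff measurableSet_ball) fun w hw hwd => ?_).trans
        (ENNReal.ofReal_le_ofReal ?_)
      · refine le_trans ?_ (norm_sub_le_norm_one_sub hz'.le (mem_ball_zero_iff.1 hwd).le)
        rw [← dist_eq_norm]
        exact not_lt.1 hw.2
      · rw [inv_mul_le_iff₀ (by positivity)]
        refine (measureReal_mono Set.sdiff_subset).trans ((key (2 * R) (by positivity)).trans_eq ?_)
        ring
    rw [hsplit]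
    refine (lintegral_union_le _ _ _).trans ((add_le_add h1 h2).trans ?_)
    rw [← hsplit, ← ENNReal.ofReal_add ?_ (by positivity)]
    · refine ENNReal.ofReal_le_ofReal ?_
      have h3 : (16 * C + 4096 * C ^ 2) / S.real (ball z (2 * R)) ≤
          4096 * C ^ 2 / S.real (ball z R) := by
        rw [div_le_div_iff₀ hS2 hS1]
        calc (16 * C + 4096 * C ^ 2) * S.real (ball z R)
            ≤ (16 * C + 4096 * C ^ 2) * ((1 - 1 / (256 * C)) * S.real (ball z (2 * R))) := by
              gcongr
          _ = (4096 * C ^ 2 - 1 / 16) * S.real (ball z (2 * R)) := by field_simp; ring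
          _ ≤ _ := by gcongr; linarith
      rw [add_div] at h3
      linarith
    · have h4 : 4096 * C ^ 2 / S.real (ball z R) ≤ 4096 * C ^ 2 / S.real (ball z δ) := by gcongr
      have h5 : 0 ≤ C / S.real (ball z δ) := by positivity
      rw [add_div]
      linarith

/-- The upper bound for the norm of `R_z` in `L²(ω dA)`. -/
theorem exists_lintegral_unweightedKernel_le {W S : Measure ℂ} {C : ℝ} (h : A2Pair W S C) :
    ∃ K, 0 < K ∧ ∀ z ∈ disk, ∀ δ, 0 < δ → δ ≤ 1 - ‖z‖ →
      ∫⁻ w, ‖unweightedKernel z w‖ₑ ^ 2 ∂W ≤ ENNReal.ofReal (K * (W.real (ball z δ) / δ ^ 4)) := by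
  have := h.finite_left
  have := h.finite_right
  have hC := h.one_le
  refine ⟨36 * (4096 * C ^ 2 + 17 * C), by positivity, fun z hz δ hδ hδz => ?_⟩
  have hz' : ‖z‖ < 1 := by simpa using hz
  have hδ1 : δ ≤ 1 := by linarith [norm_nonneg z]
  have hsub : ball z δ ⊆ disk := ball_subset_ball' (by rw [dist_zero_right]; linarith)
  have hS0 := h.symm.real_ball_pos hz hδ
  obtain ⟨k, hk1, hk2⟩ := exists_nat_pow_near ((one_le_inv₀ hδ).2 hδ1) one_lt_two
  have hk1' : 2 ^ k * δ ≤ 1 := by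
    have := mul_le_mul_of_nonneg_right hk1 hδ.le
    rwa [inv_mul_cancel₀ hδ.ne'] at this
  have hk2' : 1 / 2 ≤ 2 ^ k * δ := by
    have := mul_lt_mul_of_pos_right hk2 hδ
    rw [inv_mul_cancel₀ hδ.ne', pow_succ] at this
    linarith
  have h1 := h.setLIntegral_dyadic_le hz hδ hδz k hk1'
  have hk0 := h.symm.real_ball_pos hz (R := 2 ^ k * δ) (by positivity)
  have h2 : ∫⁻ w in (ball z (2 ^ k * δ))ᶜ, ENNReal.ofReal ((‖1 - conj z * w‖ ^ 4)⁻¹) ∂W ≤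
      ENNReal.ofReal (16 * C / S.real (ball z δ)) := by
    refine (setLIntegral_inv_pow_le h.measure_compl_disk (R := 1 / 2) (by norm_num)
      measurableSet_ball.compl fun w hw hwd => ?_).trans (ENNReal.ofReal_le_ofReal ?_)
    · refine le_trans ?_ (norm_sub_le_norm_one_sub hz'.le (mem_ball_zero_iff.1 hwd).le)
      rw [← dist_eq_norm]
      exact hk2'.trans (not_lt.1 hw)
    · rw [le_div_iff₀ hS0]
      have h3 : W.real (ball z (2 ^ k * δ))ᶜ ≤ W.real Set.univ := measureReal_mono (Set.subset_univ _)
      have h4 : S.real (ball z δ) ≤ S.real Set.univ := measureReal_mono (Set.subset_univ _)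
      have h5 := h.real_univ_mul_univ_le
      have h6 : W.real (ball z (2 ^ k * δ))ᶜ * S.real (ball z δ) ≤
          W.real Set.univ * S.real Set.univ := by gcongr
      rw [show ((1 / 2 : ℝ) ^ 4)⁻¹ = 16 by norm_num]
      linarith
  have h3 : ∫⁻ w, ENNReal.ofReal ((‖1 - conj z * w‖ ^ 4)⁻¹) ∂W ≤
      ENNReal.ofReal ((4096 * C ^ 2 + 17 * C) * (W.real (ball z δ) / δ ^ 4)) := by
    rw [← lintegral_add_compl _ (measurableSet_ball (x := z) (ε := 2 ^ k * δ))]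
    refine (add_le_add (h1.trans (ENNReal.ofReal_le_ofReal (sub_le_self _ (by positivity))))
      h2).trans ?_
    rw [← ENNReal.ofReal_add (by positivity) (by positivity), ← add_div]
    refine ENNReal.ofReal_le_ofReal ?_
    have h4 := h.sq_le (ball z δ) measurableSet_ball
    rw [area_real_ball_of_subset hδ.le hsub] at h4
    have h5 : (S.real (ball z δ))⁻¹ ≤ W.real (ball z δ) / δ ^ 4 := by
      rw [le_div_iff₀ (by positivity), inv_mul_le_iff₀ hS0]
      linarith
    rw [div_eq_mul_inv]
    calc _ ≤ (4096 * C ^ 2 + C + 16 * C) * (W.real (ball z δ) / δ ^ 4) := by gcongr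
      _ = _ := by ring
  rw [mul_assoc, ENNReal.ofReal_mul (by norm_num)]
  refine le_trans ?_ (mul_le_mul_right h3 _)
  rw [← lintegral_const_mul' _ _ ENNReal.ofReal_ne_top]
  refine lintegral_mono_ae ?_
  filter_upwards [ae_iff.2 h.measure_compl_disk] with w hw
  rw [← ofReal_norm, ← ENNReal.ofReal_pow (norm_nonneg _), ← ENNReal.ofReal_mul (by norm_num)]
  refine ENNReal.ofReal_le_ofReal ((pow_le_pow_left₀ (norm_nonneg _)
    (norm_unweightedKernel_le hz hw) 2).trans_eq ?_)
  rw [mul_pow, inv_pow, ← pow_mul]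
  norm_num

theorem tendsto_norm_toBoundary : Tendsto (fun z : ℂ => ‖z‖) toBoundary (𝓝 1) :=
  tendsto_comap.mono_right nhdsWithin_le_nhds

theorem eventually_mem_disk : ∀ᶠ z in toBoundary, z ∈ disk := by
  have : ∀ᶠ x : ℝ in 𝓝[<] 1, x < 1 := self_mem_nhdsWithin
  filter_upwards [tendsto_comap.eventually this] with z hz
  simpa using hz

/-- The norm of `R_z` tends to infinity at the boundary, because it is bounded below by the
reciprocal of the `ω⁻¹`-measure of a small disk. -/
theorem tendsto_lintegral_unweightedKernel {W S : Measure ℂ} {C : ℝ} (h : A2Pair W S C) :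
    Tendsto (fun z => ∫⁻ w, ‖unweightedKernel z w‖ₑ ^ 2 ∂W) toBoundary (𝓝 ∞) := by
  have := h.finite_left
  have := h.finite_right
  have hA : Tendsto (fun z : ℂ => area (ball z (1 / 8 * (1 - ‖z‖)))) toBoundary (𝓝 0) := by
    have h1 : Tendsto (fun z : ℂ => ENNReal.ofReal ((1 / 8 * (1 - ‖z‖)) ^ 2)) toBoundary (𝓝 0) := by
      have : Tendsto (fun z : ℂ => (1 / 8 * (1 - ‖z‖)) ^ 2) toBoundary
          (𝓝 ((1 / 8 * (1 - 1)) ^ 2)) :=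
        ((tendsto_norm_toBoundary.const_sub 1).const_mul _).pow 2
      simpa using ENNReal.tendsto_ofReal this
    refine tendsto_of_tendsto_of_tendsto_of_le_of_le' tendsto_const_nhds h1
      (Eventually.of_forall fun _ => zero_le) ?_
    filter_upwards [eventually_mem_disk] with z hz
    have hz' : ‖z‖ < 1 := by simpa using hz
    rw [← ofReal_measureReal]
    exact ENNReal.ofReal_le_ofReal (area_real_ball_le (by linarith))
  have hS : Tendsto (fun z : ℂ => S (ball z (1 / 8 * (1 - ‖z‖)))) toBoundary (𝓝 0) := by
    have h2 : ∀ E, MeasurableSet E → ∫⁻ x in E, S.rnDeriv area x ∂area = S E := fun E hE =>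
      Measure.setLIntegral_rnDeriv h.ac_right E
    have h3 := tendsto_setLIntegral_zero (f := S.rnDeriv area)
      (Measure.lintegral_rnDeriv_lt_top S area).ne hA
    exact h3.congr fun z => h2 _ measurableSet_ball
  have hinv : Tendsto (fun z : ℂ => ENNReal.ofReal ((64 * 4096)⁻¹) *
      (S (ball z (1 / 8 * (1 - ‖z‖))))⁻¹) toBoundary (𝓝 ∞) := by
    have h4 := ENNReal.Tendsto.const_mul (a := ENNReal.ofReal ((64 * 4096)⁻¹))
      (tendsto_inv_iff.2 hS) (Or.inr ENNReal.ofReal_ne_top)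
    rwa [ENNReal.inv_zero, ENNReal.mul_top (by simp)] at h4
  refine tendsto_nhds_top_mono hinv ?_
  filter_upwards [eventually_mem_disk] with z hz
  have hz' : ‖z‖ < 1 := by simpa using hz
  set δ := 1 - ‖z‖ with hδ
  have hδ0 : 0 < δ := by linarith
  refine le_trans ?_ (mul_measure_pseudoDisk_le W hz)
  refine le_trans ?_ (mul_le_mul_right (measure_mono (ball_subset_pseudoDisk hz
    (s := 1 / 8) (by norm_num) le_rfl)) _)
  rw [← hδ, ← ofReal_measureReal (μ := W), ← ofReal_measureReal (μ := S)]
  have hS0 := h.symm.real_ball_pos hz (R := 1 / 8 * δ) (by positivity)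
  have hsub : ball z (1 / 8 * δ) ⊆ disk :=
    ball_subset_ball' (by rw [dist_zero_right]; linarith)
  rw [← ENNReal.ofReal_inv_of_pos hS0, ← ENNReal.ofReal_mul (by positivity),
    ← ENNReal.ofReal_mul (by positivity)]
  refine ENNReal.ofReal_le_ofReal ?_
  have h4 := h.sq_le (ball z (1 / 8 * δ)) measurableSet_ball
  rw [area_real_ball_of_subset (by positivity) hsub] at h4
  rw [← div_eq_mul_inv, ← div_eq_inv_mul, div_le_div_iff₀ hS0 (by positivity)]
  have h5 : ((1 / 8 * δ) ^ 2) ^ 2 = δ ^ 4 / 4096 := by ring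
  rw [h5] at h4
  have h6 : (64 * 4096 : ℝ)⁻¹ * (64 * δ ^ 4) = δ ^ 4 / 4096 := by ring
  rw [h6]
  exact h4

/-! ### Compactness implies that the Berezin transform vanishes at the boundary -/

/-- On the span of the kernels, the sesquilinear form of the Toeplitz operator is the inner product
of `L²(ν)`. -/
theorem inner_toeplitz_eq {ω : ℂ → ℝ} (hω : IsA2Weight ω) {ν : Measure ℂ} (hν : ν diskᶜ = 0)
    {f g : bergman ω} (hfg : IsToeplitzImage ω ν f g) {k : bergman ω}
    (hk : k ∈ Submodule.span ℂ (kernel ω '' disk)) :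
    Integrable (fun w => rep f w * conj (rep k w)) ν ∧
      inner ℂ k g = ∫ w, rep f w * conj (rep k w) ∂ν := by
  have hd : ∀ᵐ w ∂ν, w ∈ disk := ae_iff.2 hν
  induction hk using Submodule.span_induction with
  | mem k hk =>
    obtain ⟨z, hz, rfl⟩ := hk
    exact ⟨(hfg z hz).1, by rw [← rep_eq_inner_kernel hω hz]; exact (hfg z hz).2⟩
  | zero =>
    have h0 : (fun w => rep f w * conj (rep (0 : bergman ω) w)) =ᵐ[ν] fun _ => (0 : ℂ) := by
      filter_upwards [hd] with w hw
      have := rep_smul hω 0 (0 : bergman ω) hw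
      rw [zero_smul, zero_mul] at this
      rw [this, map_zero, mul_zero]
    refine ⟨(integrable_congr h0).2 (integrable_zero _ _ _), ?_⟩
    rw [integral_congr_ae h0, integral_zero]
    exact inner_zero_left (𝕜 := ℂ) g
  | add k l _ _ hk hl =>
    have h0 : (fun w => rep f w * conj (rep (k + l) w)) =ᵐ[ν]
        fun w => rep f w * conj (rep k w) + rep f w * conj (rep l w) := by
      filter_upwards [hd] with w hw
      rw [rep_add hω k l hw, map_add, mul_add]
    refine ⟨(integrable_congr h0).2 (hk.1.add hl.1), ?_⟩
    rw [integral_congr_ae h0, integral_add hk.1 hl.1, ← hk.2, ← hl.2]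
    exact inner_add_left (𝕜 := ℂ) k l g
  | smul c k _ hk =>
    have h0 : (fun w => rep f w * conj (rep (c • k) w)) =ᵐ[ν]
        fun w => conj c * (rep f w * conj (rep k w)) := by
      filter_upwards [hd] with w hw
      rw [rep_smul hω c k hw, map_mul, mul_left_comm]
    refine ⟨(integrable_congr h0).2 (hk.1.const_mul _), ?_⟩
    rw [integral_congr_ae h0, integral_const_mul, ← hk.2]
    exact inner_smul_left (𝕜 := ℂ) k g c

theorem lintegral_rep_sq_eq {ω : ℂ → ℝ} (hω : IsA2Weight ω) {ν : Measure ℂ} (hν : ν diskᶜ = 0)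
    {f g : bergman ω} (hfg : IsToeplitzImage ω ν f g)
    (hf : f ∈ Submodule.span ℂ (kernel ω '' disk)) :
    ∫⁻ w, ‖rep f w‖ₑ ^ 2 ∂ν = ‖(inner ℂ f g : ℂ)‖ₑ := by
  obtain ⟨hI, hE⟩ := inner_toeplitz_eq hω hν hfg hf
  have h1 : (fun w => rep f w * conj (rep f w)) = fun w => ((‖rep f w‖ ^ 2 : ℝ) : ℂ) := by
    ext w
    rw [Complex.mul_conj']
    push_cast
    rfl
  rw [h1] at hI hE
  have hI' : Integrable (fun w => ‖rep f w‖ ^ 2) ν := by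
    have := hI.norm
    simpa using this
  rw [hE, integral_complex_ofReal, ← ofReal_norm, Complex.norm_real, ofReal_norm,
    Real.enorm_of_nonneg (integral_nonneg fun w => by positivity),
    ofReal_integral_eq_lintegral_ofReal hI' (Eventually.of_forall fun w => by positivity)]
  refine lintegral_congr fun w => ?_
  rw [ENNReal.ofReal_pow (norm_nonneg _), ofReal_norm]

/-- By density of the span of the kernels and Fatou's lemma, the quadratic form of an extension of
the Toeplitz operator dominates the norm of `L²(ν)`. -/
theorem lintegral_rep_sq_le {ω : ℂ → ℝ} (hω : IsA2Weight ω) {ν : Measure ℂ} (hν : ν diskᶜ = 0)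
    {T : bergman ω →L[ℂ] bergman ω}
    (hT : ∀ f ∈ Submodule.span ℂ (kernel ω '' disk), IsToeplitzImage ω ν f (T f))
    (f : bergman ω) : ∫⁻ w, ‖rep f w‖ₑ ^ 2 ∂ν ≤ ‖(inner ℂ f (T f) : ℂ)‖ₑ := by
  obtain ⟨F, hF, hFf⟩ := mem_closure_iff_seq_limit.1 (dense_span_kernel hω f)
  have hpt : ∀ w ∈ disk, Tendsto (fun n => ‖rep (F n) w‖ₑ ^ 2) atTop (𝓝 (‖rep f w‖ₑ ^ 2)) := by
    intro w hw
    simp only [rep_eq_inner_kernel hω hw]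
    have h1 : Tendsto (fun n => (inner ℂ (kernel ω w) (F n) : ℂ)) atTop
        (𝓝 (inner ℂ (kernel ω w) f)) := Filter.Tendsto.inner tendsto_const_nhds hFf
    exact ((ENNReal.continuous_pow 2).tendsto _).comp h1.enorm
  have hlim : Tendsto (fun n => ‖(inner ℂ (F n) (T (F n)) : ℂ)‖ₑ) atTop
      (𝓝 ‖(inner ℂ f (T f) : ℂ)‖ₑ) := by
    have h1 : Tendsto (fun n => (inner ℂ (F n) (T (F n)) : ℂ)) atTop
        (𝓝 (inner ℂ f (T f))) := Filter.Tendsto.inner hFf ((T.continuous.tendsto f).comp hFf)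
    exact h1.enorm
  calc ∫⁻ w, ‖rep f w‖ₑ ^ 2 ∂ν = ∫⁻ w, liminf (fun n => ‖rep (F n) w‖ₑ ^ 2) atTop ∂ν := by
        refine lintegral_congr_ae ?_
        filter_upwards [ae_iff.2 hν] with w hw
        exact (hpt w hw).liminf_eq.symm
    _ ≤ liminf (fun n => ∫⁻ w, ‖rep (F n) w‖ₑ ^ 2 ∂ν) atTop := lintegral_liminf_le' fun n =>
        (aestronglyMeasurable_of_harmonic hν (harmonicOnNhd_rep _)).enorm.pow_const 2
    _ = liminf (fun n => ‖(inner ℂ (F n) (T (F n)) : ℂ)‖ₑ) atTop := by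
        congr 1
        ext n
        exact lintegral_rep_sq_eq hω hν (hT _ (hF n)) (hF n)
    _ = _ := hlim.liminf_eq

/-- The function `R_z` belongs to the weighted harmonic Bergman space. -/
theorem exists_rep_eqOn_unweightedKernel {ω : ℂ → ℝ} (hω : IsA2Weight ω) {z : ℂ} (hz : z ∈ disk) :
    ∃ f : bergman ω, Set.EqOn (rep f) (unweightedKernel z) disk ∧
      ‖f‖ₑ ^ 2 = ∫⁻ w, ‖unweightedKernel z w‖ₑ ^ 2 ∂(weighted ω) := by
  have hfin : IsFiniteMeasure (weighted ω) := ⟨(weighted_apply_univ_ne_top hω).lt_top⟩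
  have h0 : weighted ω diskᶜ = 0 := weighted_absolutelyContinuous ω area_compl_disk
  have hm : MemLp (unweightedKernel z) 2 (weighted ω) := by
    refine MemLp.of_bound (aestronglyMeasurable_of_harmonic h0 (harmonicOnNhd_unweightedKernel hz))
      (6 * ((1 - ‖z‖) ^ 2)⁻¹) ?_
    filter_upwards [ae_iff.2 h0] with w hw using norm_unweightedKernel_le_left hz hw
  let f : bergman ω := ⟨hm.toLp, unweightedKernel z, harmonicOnNhd_unweightedKernel hz, hm.coeFn_toLp⟩
  exact ⟨f, rep_eqOn hω f (harmonicOnNhd_unweightedKernel hz) hm.coeFn_toLp,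
    (lintegral_enorm_sq_eq hm.toLp hm.coeFn_toLp).symm⟩

/-- If `u` tends weakly to zero relative to its norm and `T` is compact, then `⟨u, T u⟩ = o(‖u‖²)`. -/
theorem eventually_norm_inner_le_of_compact {H α : Type*} [NormedAddCommGroup H]
    [InnerProductSpace ℂ H] {T : H →L[ℂ] H} (hT : IsCompactOperator T) {l : Filter α} {u : α → H}
    (hu : ∀ h : H, ∀ ε > 0, ∀ᶠ x in l, ‖(inner ℂ h (u x) : ℂ)‖ ≤ ε * ‖u x‖) {ε : ℝ} (hε : 0 < ε) :
    ∀ᶠ x in l, ‖(inner ℂ (u x) (T (u x)) : ℂ)‖ ≤ ε * ‖u x‖ ^ 2 := by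
  have hc : TotallyBounded (T '' closedBall 0 1) :=
    (hT.isCompact_closure_image_closedBall 1).totallyBounded.subset subset_closure
  obtain ⟨t, ht, hcov⟩ := Metric.totallyBounded_iff.1 hc (ε / 2) (by positivity)
  filter_upwards [(ht.eventually_all).2 fun y _ => hu y (ε / 2) (by positivity)] with x hx
  by_cases h0 : u x = 0
  · simp [h0]
  have hpos : 0 < ‖u x‖ := norm_pos_iff.2 h0
  have hmem : T (((‖u x‖⁻¹ : ℝ) : ℂ) • u x) ∈ T '' closedBall 0 1 := by
    refine Set.mem_image_of_mem _ ?_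
    rw [mem_closedBall_zero_iff, norm_smul, Complex.norm_real, norm_inv, norm_norm,
      inv_mul_cancel₀ hpos.ne']
  obtain ⟨y, hy, hxy⟩ := Set.mem_iUnion₂.1 (hcov hmem)
  have h1 : ‖T (u x) - (‖u x‖ : ℂ) • y‖ ≤ ε / 2 * ‖u x‖ := by
    have h2 : T (u x) - (‖u x‖ : ℂ) • y =
        (‖u x‖ : ℂ) • (T (((‖u x‖⁻¹ : ℝ) : ℂ) • u x) - y) := by
      have : (‖u x‖ : ℂ) ≠ 0 := by exact_mod_cast hpos.ne'
      rw [map_smul, smul_sub, smul_smul]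
      push_cast
      rw [mul_inv_cancel₀ this, one_smul]
    rw [h2, norm_smul, Complex.norm_real, norm_norm, mul_comm]
    rw [mem_ball, dist_eq_norm] at hxy
    gcongr
  have h3 : (inner ℂ (u x) (T (u x)) : ℂ) =
      inner ℂ (u x) (T (u x) - (‖u x‖ : ℂ) • y) + ‖u x‖ * inner ℂ (u x) y := by
    rw [inner_sub_right, inner_smul_right]
    ring
  have h4 : ‖(inner ℂ (u x) y : ℂ)‖ ≤ ε / 2 * ‖u x‖ := by
    rw [norm_inner_symm]
    exact hx y hy
  rw [h3]
  refine (norm_add_le _ _).trans ?_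
  rw [norm_mul, Complex.norm_real, norm_norm]
  have h5 := norm_inner_le_norm (𝕜 := ℂ) (u x) (T (u x) - (‖u x‖ : ℂ) • y)
  nlinarith [mul_le_mul_of_nonneg_left h1 hpos.le, mul_le_mul_of_nonneg_left h4 hpos.le]

theorem tendsto_berezin_of_isCompactToeplitz {ω : ℂ → ℝ} (hω : IsA2Weight ω) {ν : Measure ℂ}
    (hν : ν diskᶜ = 0) (h : IsCompactToeplitz ω ν) :
    Tendsto (berezin ω ν) toBoundary (𝓝 0) := by
  obtain ⟨T, hTc, hT⟩ := h
  obtain ⟨C, hC⟩ := hω.exists_a2Pair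
  have hex : ∀ z, ∃ f : bergman ω, z ∈ disk → Set.EqOn (rep f) (unweightedKernel z) disk ∧
      ‖f‖ₑ ^ 2 = ∫⁻ w, ‖unweightedKernel z w‖ₑ ^ 2 ∂(weighted ω) := fun z => by
    by_cases hz : z ∈ disk
    · obtain ⟨f, hf⟩ := exists_rep_eqOn_unweightedKernel hω hz
      exact ⟨f, fun _ => hf⟩
    · exact ⟨0, fun h => absurd h hz⟩
  choose r hr using hex
  have hnorm : Tendsto (fun z => ‖r z‖ ^ 2) toBoundary atTop := by
    rw [← ENNReal.tendsto_ofReal_nhds_top]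
    refine (tendsto_lintegral_unweightedKernel hC).congr' ?_
    filter_upwards [eventually_mem_disk] with z hz
    rw [← (hr z hz).2, ENNReal.ofReal_pow (norm_nonneg _), ofReal_norm]
  have hspan : ∀ k ∈ Submodule.span ℂ (kernel ω '' disk), ∃ M : ℝ, ∀ z ∈ disk,
      ‖(inner ℂ k (r z) : ℂ)‖ ≤ M := by
    intro k hk
    induction hk using Submodule.span_induction with
    | mem k hk =>
      obtain ⟨a, ha, rfl⟩ := hk
      refine ⟨6 * ((1 - ‖a‖) ^ 2)⁻¹, fun z hz => ?_⟩
      rw [← rep_eq_inner_kernel hω ha, (hr z hz).1 ha]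
      exact norm_unweightedKernel_le_right hz ha
    | zero => exact ⟨0, fun z _ => by rw [inner_zero_left (𝕜 := ℂ) (r z), norm_zero]⟩
    | add k l _ _ hk hl =>
      obtain ⟨M, hM⟩ := hk
      obtain ⟨N, hN⟩ := hl
      refine ⟨M + N, fun z hz => ?_⟩
      rw [inner_add_left (𝕜 := ℂ) k l (r z)]
      exact (norm_add_le _ _).trans (add_le_add (hM z hz) (hN z hz))
    | smul c k _ hk =>
      obtain ⟨M, hM⟩ := hk
      refine ⟨‖c‖ * M, fun z hz => ?_⟩
      rw [inner_smul_left (𝕜 := ℂ) k (r z) c, norm_mul, RCLike.norm_conj]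
      gcongr
      exact hM z hz
  have hweak : ∀ h : bergman ω, ∀ ε > 0, ∀ᶠ z in toBoundary,
      ‖(inner ℂ h (r z) : ℂ)‖ ≤ ε * ‖r z‖ := by
    intro h ε hε
    obtain ⟨k, hk, hhk⟩ := Metric.mem_closure_iff.1 (dense_span_kernel hω h) (ε / 2) (by positivity)
    obtain ⟨M, hM⟩ := hspan k hk
    rw [dist_eq_norm] at hhk
    filter_upwards [eventually_mem_disk, hnorm.eventually_ge_atTop ((2 * |M| / ε) ^ 2)] with z hz hz2
    have h1 : 2 * |M| / ε ≤ ‖r z‖ := le_of_sq_le_sq hz2 (norm_nonneg _)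
    rw [div_le_iff₀ hε] at h1
    have h2 : (inner ℂ h (r z) : ℂ) = inner ℂ (h - k) (r z) + inner ℂ k (r z) := by
      rw [← inner_add_left (𝕜 := ℂ) (h - k) k (r z), sub_add_cancel]
    have h3 := norm_inner_le_norm (𝕜 := ℂ) (h - k) (r z)
    rw [h2]
    refine (norm_add_le _ _).trans ?_
    have h4 := hM z hz
    have h5 := le_abs_self M
    nlinarith [norm_nonneg (r z)]
  rw [ENNReal.tendsto_nhds_zero]
  intro ε hε
  obtain ⟨ε', hε'0, hε'⟩ := ENNReal.lt_iff_exists_nnreal_btwn.1 hε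
  have hε'' : (0 : ℝ) < ε' := by exact_mod_cast hε'0
  filter_upwards [eventually_mem_disk,
    eventually_norm_inner_le_of_compact hTc hweak hε''] with z hz h1
  refine le_trans ?_ hε'.le
  refine ENNReal.div_le_of_le_mul ?_
  rw [← (hr z hz).2]
  calc ∫⁻ w, ‖unweightedKernel z w‖ₑ ^ 2 ∂ν = ∫⁻ w, ‖rep (r z) w‖ₑ ^ 2 ∂ν := by
        refine lintegral_congr_ae ?_
        filter_upwards [ae_iff.2 hν] with w hw
        rw [(hr z hz).1 hw]
    _ ≤ ‖(inner ℂ (r z) (T (r z)) : ℂ)‖ₑ := lintegral_rep_sq_le hω hν hT (r z)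
    _ = ENNReal.ofReal ‖(inner ℂ (r z) (T (r z)) : ℂ)‖ := (ofReal_norm _).symm
    _ ≤ ENNReal.ofReal (ε' * ‖r z‖ ^ 2) := ENNReal.ofReal_le_ofReal h1
    _ = _ := by
        rw [ENNReal.ofReal_mul hε''.le, ENNReal.ofReal_pow (norm_nonneg _), ofReal_norm,
          ENNReal.ofReal_coe_nnreal]

/-! ### The Berezin transform controls the averages over pseudohyperbolic disks -/

theorem isVanishingCarleson_of_tendsto_berezin {ω : ℂ → ℝ} (hω : IsA2Weight ω) {ν : Measure ℂ}
    (h : Tendsto (berezin ω ν) toBoundary (𝓝 0)) : IsVanishingCarleson ω ν := by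
  obtain ⟨C, hC⟩ := hω.exists_a2Pair
  have := hC.finite_left
  obtain ⟨K, hK0, hK⟩ := exists_lintegral_unweightedKernel_le hC
  refine ⟨1 / 8, by norm_num, ?_⟩
  have h0 := ENNReal.Tendsto.const_mul (a := ENNReal.ofReal (64 * 4096 * K)) h
    (Or.inr ENNReal.ofReal_ne_top)
  rw [mul_zero] at h0
  refine tendsto_of_tendsto_of_tendsto_of_le_of_le' tendsto_const_nhds h0
    (Eventually.of_forall fun _ => zero_le) ?_
  filter_upwards [eventually_mem_disk] with z hz
  have hz' : ‖z‖ < 1 := mem_ball_zero_iff.1 hz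
  set δ := 1 - ‖z‖ with hδ
  have hδ0 : 0 < δ := by linarith
  have hsub : ball z (1 / 8 * δ) ⊆ pseudoDisk z (1 / 8) :=
    ball_subset_pseudoDisk hz (by norm_num) le_rfl
  have hW0 : 0 < (weighted ω).real (pseudoDisk z (1 / 8)) :=
    (hC.real_ball_pos hz (by positivity)).trans_le (measureReal_mono hsub)
  set N := ∫⁻ w, ‖unweightedKernel z w‖ₑ ^ 2 ∂ν
  set M := ∫⁻ w, ‖unweightedKernel z w‖ₑ ^ 2 ∂(weighted ω) with hM
  have hM1 : M ≤ ENNReal.ofReal (K * ((weighted ω).real (pseudoDisk z (1 / 8)) /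
      (1 / 8 * δ) ^ 4)) := by
    refine (hK z hz (1 / 8 * δ) (by positivity) (by linarith)).trans (ENNReal.ofReal_le_ofReal ?_)
    have := measureReal_mono (μ := weighted ω) hsub
    gcongr
  have hM0 : M ≠ 0 := by
    refine (lt_of_lt_of_le ?_ (mul_measure_pseudoDisk_le (weighted ω) hz)).ne'
    rw [← ofReal_measureReal, ← ENNReal.ofReal_mul (by positivity), ENNReal.ofReal_pos]
    positivity
  have hN : N = berezin ω ν z * M :=
    (ENNReal.div_mul_cancel hM0 (hM1.trans_lt ENNReal.ofReal_lt_top).ne).symm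
  have h1 : ν (pseudoDisk z (1 / 8)) ≤ ENNReal.ofReal (64 * δ ^ 4) * N := by
    refine le_trans ?_ (mul_le_mul_right (mul_measure_pseudoDisk_le ν hz) _)
    rw [← mul_assoc, ← ENNReal.ofReal_mul (by positivity), mul_inv_cancel₀ (by positivity)]
    simp
  refine ENNReal.div_le_of_le_mul (h1.trans ?_)
  rw [hN]
  calc ENNReal.ofReal (64 * δ ^ 4) * (berezin ω ν z * M)
      ≤ ENNReal.ofReal (64 * δ ^ 4) * (berezin ω ν z * ENNReal.ofReal
        (K * ((weighted ω).real (pseudoDisk z (1 / 8)) / (1 / 8 * δ) ^ 4))) := by gcongr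
    _ = ENNReal.ofReal (64 * δ ^ 4) * ENNReal.ofReal
        (K * ((weighted ω).real (pseudoDisk z (1 / 8)) / (1 / 8 * δ) ^ 4)) * berezin ω ν z := by
        ring
    _ = ENNReal.ofReal (64 * 4096 * K * (weighted ω).real (pseudoDisk z (1 / 8))) *
        berezin ω ν z := by
        rw [← ENNReal.ofReal_mul (by positivity)]
        congr 2
        field_simp
        norm_num
    _ = _ := by
        rw [ENNReal.ofReal_mul (by positivity), ofReal_measureReal]
        ring

/-! ### The Carleson embedding -/

/-- Pseudohyperbolic disks and small Euclidean disks with nearby centres have comparable weighted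
measures. -/
theorem A2Pair.real_pseudoDisk_le {W S : Measure ℂ} {C : ℝ} (h : A2Pair W S C) {r : ℝ}
    (hr0 : 0 < r) (hr1 : r < 1) {z w : ℂ} (hz : z ∈ disk) (hw : w ∈ ball z (r / 2 * (1 - ‖z‖))) :
    W.real (pseudoDisk w r) ≤
      10000 * C / (r ^ 4 * (1 - r) ^ 4) * W.real (ball z (r / 2 * (1 - ‖z‖))) := by
  have := h.finite_left
  have hC := h.one_le
  have hz' : ‖z‖ < 1 := mem_ball_zero_iff.1 hz
  set δ := 1 - ‖z‖ with hδ
  have hδ0 : 0 < δ := by linarith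
  have h1r : 0 < 1 - r := by linarith
  have hwd : w ∈ disk := (ball_subset_pseudoDisk hz (by linarith) le_rfl hw).1
  have hw' : ‖w‖ < 1 := mem_ball_zero_iff.1 hwd
  rw [mem_ball, dist_eq_norm] at hw
  have hδw : 1 - ‖w‖ ≤ 2 * δ := by
    have := norm_sub_norm_le z w
    rw [norm_sub_rev] at this
    nlinarith
  have hsub : pseudoDisk w r ⊆ ball z (5 * δ / (1 - r)) := by
    rintro v ⟨hv, hvr⟩
    have hne := one_sub_ne_zero hwd hv
    rw [norm_div, div_lt_iff₀ (norm_pos_iff.2 hne)] at hvr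
    have h1 : ‖1 - conj w * v‖ ≤ 2 * (1 - ‖w‖) + ‖v - w‖ := by
      have h2 : 1 - conj w * v = ((1 - ‖w‖ ^ 2 : ℝ) : ℂ) - conj w * (v - w) := by
        have : conj w * w = (‖w‖ : ℂ) ^ 2 := by rw [mul_comm, Complex.mul_conj']
        push_cast
        linear_combination -this
      rw [h2]
      refine (norm_sub_le _ _).trans ?_
      rw [Complex.norm_real, Real.norm_of_nonneg (by nlinarith [norm_nonneg w]), norm_mul,
        RCLike.norm_conj]
      nlinarith [norm_nonneg w, norm_nonneg (v - w)]
    have h3 : ‖v - w‖ * (1 - r) < 4 * δ := by nlinarith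
    have h4 : ‖v - z‖ ≤ ‖v - w‖ + ‖w - z‖ := norm_sub_le_norm_sub_add_norm_sub v w z
    have h5 : ‖w - z‖ * (1 - r) ≤ ‖w - z‖ :=
      mul_le_of_le_one_right (norm_nonneg _) (by linarith)
    have h6 : r / 2 * δ ≤ 1 * δ := by gcongr; linarith
    have h7 := mul_le_mul_of_nonneg_right h4 h1r.le
    rw [mem_ball, dist_eq_norm, lt_div_iff₀ h1r]
    linarith
  have hβ : ball z (r / 2 * δ) ⊆ disk := by
    refine ball_subset_ball' ?_
    rw [dist_zero_right]
    nlinarith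
  have hle : r / 2 * δ ≤ 5 * δ / (1 - r) := by
    rw [le_div_iff₀ h1r]
    have h1 : r / 2 * δ * (1 - r) ≤ r / 2 * δ :=
      mul_le_of_le_one_right (by positivity) (by linarith)
    have h2 : r / 2 * δ ≤ 5 * δ := by gcongr; linarith
    exact h1.trans h2
  have h5 := h.mul_sq_le hz (R := 5 * δ / (1 - r)) (by positivity)
    (measurableSet_ball (x := z) (ε := r / 2 * δ)) (ball_subset_ball hle)
  rw [area_real_ball_of_subset (by positivity) hβ] at h5
  have h6 := area_real_ball_le (c := z) (r := 5 * δ / (1 - r)) (by positivity)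
  have h7 : W.real (pseudoDisk w r) ≤ W.real (ball z (5 * δ / (1 - r))) := measureReal_mono hsub
  have hp : 0 < ((r / 2 * δ) ^ 2) ^ 2 := by positivity
  refine h7.trans (le_of_mul_le_mul_right ?_ hp)
  calc _ ≤ _ := h5
    _ ≤ C * ((5 * δ / (1 - r)) ^ 2) ^ 2 * W.real (ball z (r / 2 * δ)) := by gcongr
    _ = _ := by field_simp; ring

/-- A point of a small Euclidean disk about `z` has `z` in its pseudohyperbolic disk. -/
theorem mem_pseudoDisk_of_mem_ball {r : ℝ} (hr0 : 0 < r) (hr1 : r < 1) {z w : ℂ} (hz : z ∈ disk)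
    (hw : w ∈ ball z (r / 2 * (1 - ‖z‖))) : z ∈ pseudoDisk w r ∧ 1 - ‖w‖ ≤ 2 * (1 - ‖z‖) := by
  have hz' : ‖z‖ < 1 := mem_ball_zero_iff.1 hz
  have hwd : w ∈ disk := (ball_subset_pseudoDisk hz (by linarith) le_rfl hw).1
  rw [mem_ball, dist_eq_norm] at hw
  have h1 := norm_sub_norm_le w z
  have h2 := norm_sub_norm_le z w
  rw [norm_sub_rev] at h2
  refine ⟨ball_subset_pseudoDisk hwd hr1.le le_rfl ?_, by nlinarith⟩
  rw [mem_ball, dist_comm, dist_eq_norm]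
  nlinarith

/-- A Carleson estimate near the boundary: the pointwise bound by local mean squares is integrated
with respect to `ν`, and the order of integration is interchanged. -/
theorem lintegral_compl_closedBall_le {ω : ℂ → ℝ} (hω : IsA2Weight ω) {C : ℝ}
    (hC : A2Pair (weighted ω) (weighted fun z => (ω z)⁻¹) C) {ν : Measure ℂ} [IsFiniteMeasure ν]
    (hν : ν diskᶜ = 0) {r : ℝ} (hr0 : 0 < r) (hr1 : r < 1) {ρ B : ℝ}
    (hB : ∀ w ∈ disk, 1 - ‖w‖ ≤ 2 * (1 - ρ) →
      ν (pseudoDisk w r) ≤ ENNReal.ofReal B * weighted ω (pseudoDisk w r)) (f : bergman ω) :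
    ∫⁻ z in (closedBall 0 ρ)ᶜ, ‖rep f z‖ₑ ^ 2 ∂ν ≤
      ENNReal.ofReal C * (ENNReal.ofReal (10000 * C / (r ^ 4 * (1 - r) ^ 4)) * ENNReal.ofReal B) *
        ‖f‖ₑ ^ 2 := by
  have hfin := hC.finite_left
  have hC1 := hC.one_le
  have h1r : 0 < 1 - r := by linarith
  set W := weighted ω with hW
  set c : ℝ := 10000 * C / (r ^ 4 * (1 - r) ^ 4) with hc
  have hc0 : 0 ≤ c := by positivity
  set β : ℂ → Set ℂ := fun z => ball z (r / 2 * (1 - ‖z‖)) with hβ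
  set U : Set (ℂ × ℂ) := {p | dist p.2 p.1 < r / 2 * (1 - ‖p.1‖)} with hU
  have hUm : MeasurableSet U := (isOpen_lt (by fun_prop) (by fun_prop)).measurableSet
  have hWβ : Measurable fun z => W (β z) := measurable_measure_prodMk_left hUm
  have hβ0 : ∀ z ∈ disk, W (β z) ≠ 0 := fun z hz h0 => by
    have hz' : ‖z‖ < 1 := mem_ball_zero_iff.1 hz
    have := hC.real_ball_pos hz (R := r / 2 * (1 - ‖z‖)) (mul_pos (by linarith) (by linarith))
    rw [Measure.real, h0] at this
    simp at this
  have hfm : AEMeasurable (fun w => ‖rep f w‖ₑ ^ 2) W :=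
    (aestronglyMeasurable_of_harmonic hC.measure_compl_disk
      (harmonicOnNhd_rep f)).enorm.pow_const 2
  -- the pointwise estimate
  have hpt : ∀ z ∈ disk, ‖rep f z‖ₑ ^ 2 ≤ ENNReal.ofReal C *
      ∫⁻ w, U.indicator (fun p => (W (β p.1))⁻¹) (z, w) * ‖rep f w‖ₑ ^ 2 ∂W := by
    intro z hz
    have hz' : ‖z‖ < 1 := mem_ball_zero_iff.1 hz
    have hsub : β z ⊆ disk :=
      fun w hw => (ball_subset_pseudoDisk hz (by linarith) le_rfl hw).1
    have h1 := enorm_sq_mul_weighted_le hω hC (mul_pos (by linarith) (by linarith)) hsub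
      ((harmonicOnNhd_rep f).mono hsub)
    have h2 : ∫⁻ w, U.indicator (fun p => (W (β p.1))⁻¹) (z, w) * ‖rep f w‖ₑ ^ 2 ∂W =
        (W (β z))⁻¹ * ∫⁻ w in β z, ‖rep f w‖ₑ ^ 2 ∂W := by
      rw [← lintegral_const_mul'' _ hfm.restrict, ← lintegral_indicator measurableSet_ball]
      refine lintegral_congr fun w => ?_
      by_cases hw : w ∈ β z
      · rw [Set.indicator_of_mem hw, Set.indicator_of_mem (s := U) hw]
      · rw [Set.indicator_of_notMem hw, Set.indicator_of_notMem (s := U) hw, zero_mul]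
    rw [h2, mul_left_comm, ← ENNReal.div_eq_inv_mul,
      ENNReal.le_div_iff_mul_le (Or.inl (hβ0 z hz)) (Or.inl (measure_ne_top _ _))]
    exact h1
  -- the integral in the other variable
  have hin : ∀ w ∈ disk, ∫⁻ z in (closedBall 0 ρ)ᶜ,
      U.indicator (fun p => (W (β p.1))⁻¹) (z, w) ∂ν ≤ ENNReal.ofReal c * ENNReal.ofReal B := by
    intro w hw
    have hDpos : 0 < W.real (pseudoDisk w r) := by
      have hw' : ‖w‖ < 1 := mem_ball_zero_iff.1 hw
      exact (hC.real_ball_pos hw (R := r * (1 - ‖w‖)) (mul_pos hr0 (by linarith))).trans_le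
        (measureReal_mono (ball_subset_pseudoDisk hw hr1.le le_rfl))
    have hD0 : W (pseudoDisk w r) ≠ 0 := fun h0 => by
      rw [Measure.real, h0] at hDpos
      simp at hDpos
    have hz : ∀ᵐ z ∂(ν.restrict (closedBall 0 ρ)ᶜ), z ∈ disk ∧ z ∈ (closedBall (0 : ℂ) ρ)ᶜ := by
      filter_upwards [ae_restrict_of_ae (ae_iff.2 hν),
        ae_restrict_mem isClosed_closedBall.measurableSet.compl] with z h1 h2 using ⟨h1, h2⟩
    by_cases hwρ : 1 - ‖w‖ ≤ 2 * (1 - ρ)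
    · calc ∫⁻ z in (closedBall 0 ρ)ᶜ, U.indicator (fun p => (W (β p.1))⁻¹) (z, w) ∂ν
          ≤ ∫⁻ z in (closedBall 0 ρ)ᶜ, (pseudoDisk w r).indicator
            (fun _ => ENNReal.ofReal c / W (pseudoDisk w r)) z ∂ν := by
            refine lintegral_mono_ae ?_
            filter_upwards [hz] with z hz
            by_cases hzw : (z, w) ∈ U
            · rw [Set.indicator_of_mem hzw, Set.indicator_of_mem
                (mem_pseudoDisk_of_mem_ball hr0 hr1 hz.1 hzw).1]
              have h1 := ENNReal.ofReal_le_ofReal (hC.real_pseudoDisk_le hr0 hr1 hz.1 hzw)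
              rw [ENNReal.ofReal_mul hc0, ofReal_measureReal, ofReal_measureReal] at h1
              rw [ENNReal.le_div_iff_mul_le (Or.inl hD0) (Or.inl (measure_ne_top _ _)), mul_comm,
                ← div_eq_mul_inv]
              exact ENNReal.div_le_of_le_mul h1
            · rw [Set.indicator_of_notMem hzw]
              exact zero_le
        _ ≤ ∫⁻ z, (pseudoDisk w r).indicator
            (fun _ => ENNReal.ofReal c / W (pseudoDisk w r)) z ∂ν := setLIntegral_le_lintegral _ _
        _ = ENNReal.ofReal c / W (pseudoDisk w r) * ν (pseudoDisk w r) :=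
            lintegral_indicator_const (measurableSet_pseudoDisk w r) _
        _ ≤ ENNReal.ofReal c / W (pseudoDisk w r) *
            (ENNReal.ofReal B * W (pseudoDisk w r)) := by
            gcongr
            exact hB w hw hwρ
        _ = ENNReal.ofReal c / W (pseudoDisk w r) * W (pseudoDisk w r) * ENNReal.ofReal B := by
            ring
        _ = _ := by rw [ENNReal.div_mul_cancel hD0 (measure_ne_top _ _)]
    · refine le_of_eq_of_le ?_ zero_le
      refine (lintegral_congr_ae (g := fun _ => 0) ?_).trans lintegral_zero
      filter_upwards [hz] with z hz
      refine Set.indicator_of_notMem (fun hzw => hwρ ?_) _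
      have h1 := (mem_pseudoDisk_of_mem_ball hr0 hr1 hz.1 hzw).2
      have h2 : ρ < ‖z‖ := by simpa using hz.2
      linarith
  have hjm : AEMeasurable (Function.uncurry fun z w =>
      U.indicator (fun p => (W (β p.1))⁻¹) (z, w) * ‖rep f w‖ₑ ^ 2)
      ((ν.restrict (closedBall 0 ρ)ᶜ).prod W) :=
    ((hWβ.inv.comp measurable_fst).indicator hUm).aemeasurable.mul
      (hfm.comp_quasiMeasurePreserving Measure.quasiMeasurePreserving_snd)
  calc ∫⁻ z in (closedBall 0 ρ)ᶜ, ‖rep f z‖ₑ ^ 2 ∂ν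
      ≤ ∫⁻ z in (closedBall 0 ρ)ᶜ, ENNReal.ofReal C *
        ∫⁻ w, U.indicator (fun p => (W (β p.1))⁻¹) (z, w) * ‖rep f w‖ₑ ^ 2 ∂W ∂ν := by
        refine lintegral_mono_ae ?_
        filter_upwards [ae_restrict_of_ae (ae_iff.2 hν)] with z hz using hpt z hz
    _ = ENNReal.ofReal C * ∫⁻ z in (closedBall 0 ρ)ᶜ,
        ∫⁻ w, U.indicator (fun p => (W (β p.1))⁻¹) (z, w) * ‖rep f w‖ₑ ^ 2 ∂W ∂ν :=
        lintegral_const_mul' _ _ ENNReal.ofReal_ne_top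
    _ = ENNReal.ofReal C * ∫⁻ w, ∫⁻ z in (closedBall 0 ρ)ᶜ,
        U.indicator (fun p => (W (β p.1))⁻¹) (z, w) * ‖rep f w‖ₑ ^ 2 ∂ν ∂W := by
        rw [lintegral_lintegral_swap hjm]
    _ ≤ ENNReal.ofReal C *
        ∫⁻ w, ENNReal.ofReal c * ENNReal.ofReal B * ‖rep f w‖ₑ ^ 2 ∂W := by
        refine mul_le_mul' le_rfl (lintegral_mono_ae ?_)
        filter_upwards [ae_iff.2 hC.measure_compl_disk] with w hw
        rw [lintegral_mul_const' _ _ (by finiteness)]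
        gcongr
        exact hin w hw
    _ = _ := by
        rw [lintegral_const_mul' _ _ (by finiteness),
          lintegral_enorm_sq_eq (f : Lp ℂ 2 W) (coe_ae_eq_rep f), ← mul_assoc]
        rfl

/-- For a vanishing Carleson measure, the part of the `L²(ν)` norm coming from a neighbourhood of
the boundary is a small multiple of the norm of the Bergman space. -/
theorem exists_lintegral_compl_le {ω : ℂ → ℝ} (hω : IsA2Weight ω) {ν : Measure ℂ}
    [IsFiniteMeasure ν] (hν : ν diskᶜ = 0) (h : IsVanishingCarleson ω ν) {ε : ℝ} (hε : 0 < ε) :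
    ∃ ρ, 0 < ρ ∧ ρ < 1 ∧ ∀ f : bergman ω,
      ∫⁻ z in (closedBall 0 ρ)ᶜ, ‖rep f z‖ₑ ^ 2 ∂ν ≤ ENNReal.ofReal ε * ‖f‖ₑ ^ 2 := by
  obtain ⟨C, hC⟩ := hω.exists_a2Pair
  have hfin := hC.finite_left
  have hC1 := hC.one_le
  obtain ⟨r, ⟨hr0, hr1⟩, hlim⟩ := h
  have h1r : 0 < 1 - r := by linarith
  set c : ℝ := 10000 * C / (r ^ 4 * (1 - r) ^ 4) with hc
  have hc0 : 0 < c := by positivity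
  set B : ℝ := ε / (C * c) with hB
  have hB0 : 0 < B := by positivity
  have hev := (ENNReal.tendsto_nhds_zero.1 hlim) (ENNReal.ofReal B) (by simpa using hB0)
  rw [toBoundary, eventually_comap] at hev
  obtain ⟨ρ₀, hρ₀, hev⟩ := (mem_nhdsLT_iff_exists_Ioo_subset' (zero_lt_one' ℝ)).1 hev
  have hρ₀' : ρ₀ < 1 := hρ₀
  set ρ := max (1 / 2) (1 - (1 - ρ₀) / 3) with hρ
  have h1 : 1 / 2 ≤ ρ := le_max_left _ _
  have h2 : 1 - (1 - ρ₀) / 3 ≤ ρ := le_max_right _ _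
  have h3 : ρ < 1 := max_lt (by norm_num) (by linarith)
  refine ⟨ρ, by linarith, h3, fun f => ?_⟩
  refine (lintegral_compl_closedBall_le hω hC hν hr0 hr1 (ρ := ρ) (B := B) ?_ f).trans_eq ?_
  · intro w hw hwρ
    have hw' : ‖w‖ < 1 := mem_ball_zero_iff.1 hw
    have h4 := hev (show ‖w‖ ∈ Set.Ioo ρ₀ 1 from ⟨by linarith, hw'⟩) w rfl
    have hDpos : 0 < (weighted ω).real (pseudoDisk w r) :=
      (hC.real_ball_pos hw (R := r * (1 - ‖w‖)) (mul_pos hr0 (by linarith))).trans_le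
        (measureReal_mono (ball_subset_pseudoDisk hw hr1.le le_rfl))
    have hD0 : weighted ω (pseudoDisk w r) ≠ 0 := fun h0 => by
      rw [Measure.real, h0] at hDpos
      simp at hDpos
    rwa [ENNReal.div_le_iff hD0 (measure_ne_top _ _)] at h4
  · rw [← ENNReal.ofReal_mul (by positivity), ← ENNReal.ofReal_mul (by positivity), ← hc, hB]
    congr 2
    field_simp

/-! ### Compactness of the Toeplitz operator -/

theorem isCompactOperator_rankOne {H : Type*} [NormedAddCommGroup H] [InnerProductSpace ℂ H]
    (x y : H) : IsCompactOperator (rankOne ℂ x y) := by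
  have h1 : IsCompactOperator (innerSL ℂ y) := by
    have h2 : IsCompactOperator (id : ℂ → ℂ) :=
      isCompactOperator_id_iff_finiteDimensional (𝕜 := ℂ).2 inferInstance
    exact h2.comp_clm (innerSL ℂ y)
  rw [rankOne_def']
  exact h1.clm_comp (ContinuousLinearMap.toSpanSingleton ℂ x)

/-- An operator-norm integral of compact operators is compact, since the compact operators form a
closed subspace. -/
theorem isCompactOperator_setIntegral {H : Type*} [NormedAddCommGroup H] [InnerProductSpace ℂ H]
    [CompleteSpace H] {μ : Measure ℂ} [IsFiniteMeasure μ] {Φ : ℂ → H →L[ℂ] H} {E : Set ℂ}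
    (hΦ : ∀ z, IsCompactOperator (Φ z)) (hI : IntegrableOn Φ E μ) :
    IsCompactOperator (∫ z in E, Φ z ∂μ : H →L[ℂ] H) := by
  by_cases h0 : μ E = 0
  · rw [Measure.restrict_eq_zero.2 h0, integral_zero_measure]
    exact isCompactOperator_zero
  · have hc : Convex ℝ {A : H →L[ℂ] H | IsCompactOperator A} :=
      ((compactOperator (RingHom.id ℂ) H H).restrictScalars ℝ).convex
    have h1 : IsCompactOperator (⨍ z in E, Φ z ∂μ : H →L[ℂ] H) :=
      hc.set_average_mem isClosed_setOfPred_isCompactOperator h0 (measure_ne_top _ _)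
        (ae_of_all _ hΦ) hI
    rw [← measure_smul_setAverage _ (measure_ne_top μ E)]
    exact h1.smul (μ.real E)

/-- Let `U_n` be the operator-norm integral of the rank-one operators `K_z ⊗ K_z` over the compact
set `A_n`. It is compact, and if the sesquilinear forms of the differences are uniformly small, then
the `U_n` converge in norm to a compact operator. -/
theorem exists_isCompactOperator_of_form {H : Type*} [NormedAddCommGroup H]
    [InnerProductSpace ℂ H] [CompleteSpace H] {μ : Measure ℂ} [IsFiniteMeasure μ] {K : ℂ → H}
    {A : ℕ → Set ℂ} (hmono : Monotone A) (hA : ∀ n, IsCompact (A n))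
    (hK : ∀ n, ContinuousOn K (A n))
    (htail : ∀ ε > 0, ∃ N, ∀ n ≥ N, ∀ f g : H,
      ‖∫ z in A n \ A N, (inner ℂ (K z) f * conj (inner ℂ (K z) g) : ℂ) ∂μ‖ ≤ ε * ‖f‖ * ‖g‖) :
    ∃ T : H →L[ℂ] H, IsCompactOperator T ∧ ∀ f g : H,
      Tendsto (fun n => ∫ z in A n, (inner ℂ (K z) f * conj (inner ℂ (K z) g) : ℂ) ∂μ) atTop
        (𝓝 (inner ℂ g (T f))) := by
  have hI : ∀ n, IntegrableOn (fun z => rankOne ℂ (K z) (K z)) (A n) μ := fun n =>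
    ContinuousOn.integrableOn_compact (hA n)
      ((((ContinuousLinearMap.smulRightL ℂ H H).continuous.comp
        (innerSL ℂ).continuous).comp_continuousOn (hK n)).clm_apply (hK n))
  have hI' : ∀ n, ∀ f g : H,
      IntegrableOn (fun z => (inner ℂ (K z) f * conj (inner ℂ (K z) g) : ℂ)) (A n) μ :=
    fun n f g => ContinuousOn.integrableOn_compact (hA n)
      (((hK n).inner continuousOn_const).mul
        (Complex.continuous_conj.comp_continuousOn ((hK n).inner continuousOn_const)))
  set U : ℕ → H →L[ℂ] H := fun n => ∫ z in A n, rankOne ℂ (K z) (K z) ∂μ with hU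
  have hUc : ∀ n, IsCompactOperator (U n) := fun n =>
    isCompactOperator_setIntegral (fun z => isCompactOperator_rankOne _ _) (hI n)
  have hform : ∀ n, ∀ f g : H, inner ℂ g (U n f) =
      ∫ z in A n, (inner ℂ (K z) f * conj (inner ℂ (K z) g) : ℂ) ∂μ := by
    intro n f g
    have hI2 : Integrable (fun z => rankOne ℂ (K z) (K z) f) (μ.restrict (A n)) :=
      (ContinuousLinearMap.apply ℂ H f).integrable_comp (hI n)
    rw [hU, ContinuousLinearMap.integral_apply (hI n), ← innerSL_apply_apply ℂ g,
      ← ContinuousLinearMap.integral_comp_comm _ hI2]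
    refine integral_congr_ae (ae_of_all _ fun z => ?_)
    simp only [rankOne_apply, innerSL_apply_apply, inner_smul_right, inner_conj_symm]
  have hcauchy : CauchySeq U := by
    rw [Metric.cauchySeq_iff']
    intro ε hε
    obtain ⟨N, hN⟩ := htail (ε / 2) (half_pos hε)
    refine ⟨N, fun n hn => ?_⟩
    rw [dist_eq_norm]
    refine lt_of_le_of_lt ?_ (half_lt_self hε)
    refine ContinuousLinearMap.opNorm_le_bound _ (half_pos hε).le fun f => ?_
    set g := (U n - U N) f with hg
    have h3 : (inner ℂ g g : ℂ) =
        ∫ z in A n \ A N, (inner ℂ (K z) f * conj (inner ℂ (K z) g) : ℂ) ∂μ := by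
      rw [setIntegral_sdiff (hA N).measurableSet (hI' n f g) (hmono hn), ← hform, ← hform,
        ← inner_sub_right]
      rfl
    have h5 := hN n hn f g
    rw [← h3, inner_self_eq_norm_sq_to_K, norm_pow, RCLike.norm_ofReal, abs_norm, pow_two] at h5
    by_cases h0 : ‖g‖ = 0
    · rw [h0]
      positivity
    · exact le_of_mul_le_mul_right h5 (lt_of_le_of_ne (norm_nonneg _) (Ne.symm h0))
  obtain ⟨T, hT⟩ := cauchySeq_tendsto_of_complete hcauchy
  refine ⟨T, isCompactOperator_of_tendsto hT (Eventually.of_forall hUc), fun f g => ?_⟩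
  simp only [← hform]
  refine Filter.Tendsto.inner tendsto_const_nhds ?_
  exact ((ContinuousLinearMap.apply ℂ H f).continuous.tendsto T).comp hT

theorem enorm_setIntegral_mul_conj_le {μ : Measure ℂ} {E : Set ℂ} {f g : ℂ → ℂ} {ε a b : ℝ≥0∞}
    (hf : AEStronglyMeasurable f μ) (hg : AEStronglyMeasurable g μ)
    (hfa : ∫⁻ z in E, ‖f z‖ₑ ^ 2 ∂μ ≤ ε * a ^ 2) (hgb : ∫⁻ z in E, ‖g z‖ₑ ^ 2 ∂μ ≤ ε * b ^ 2) :
    ‖∫ z in E, f z * conj (g z) ∂μ‖ₑ ≤ ε * a * b := by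
  have h := ENNReal.lintegral_mul_le_Lp_mul_Lq (μ.restrict E) Real.HolderConjugate.two_two
    hf.enorm.restrict hg.enorm.restrict
  simp only [ENNReal.rpow_two] at h
  refine (enorm_integral_le_lintegral_enorm _).trans ?_
  have h1 : ∫⁻ z in E, ‖f z * conj (g z)‖ₑ ∂μ =
      ∫⁻ z in E, ((fun z => ‖f z‖ₑ) * fun z => ‖g z‖ₑ) z ∂μ := by
    refine lintegral_congr fun z => ?_
    rw [enorm_mul, Pi.mul_apply]
    congr 1
    exact RCLike.enorm_conj (g z)
  rw [h1]
  refine h.trans ?_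
  calc _ ≤ (ε * a ^ 2) ^ (1 / 2 : ℝ) * (ε * b ^ 2) ^ (1 / 2 : ℝ) := by gcongr
    _ = ((ε * a * b) ^ 2) ^ (1 / 2 : ℝ) := by
        rw [← ENNReal.mul_rpow_of_nonneg _ _ (by norm_num)]
        congr 1
        ring
    _ = _ := by
        rw [← ENNReal.rpow_two, ← ENNReal.rpow_mul]
        norm_num

theorem memLp_rep {ω : ℂ → ℝ} (hω : IsA2Weight ω) {ν : Measure ℂ} [IsFiniteMeasure ν]
    (hν : ν diskᶜ = 0) (h : IsVanishingCarleson ω ν) (f : bergman ω) : MemLp (rep f) 2 ν := by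
  obtain ⟨ρ, hρ0, hρ1, hρ⟩ := exists_lintegral_compl_le hω hν h one_pos
  obtain ⟨M, hM0, hM⟩ := exists_norm_rep_le hω hρ0.le hρ1
  refine ⟨aestronglyMeasurable_of_harmonic hν (harmonicOnNhd_rep f), ?_⟩
  rw [eLpNorm_lt_top_iff_lintegral_rpow_enorm_lt_top two_ne_zero ENNReal.ofNat_ne_top]
  simp only [ENNReal.toReal_ofNat, ENNReal.rpow_two]
  rw [← lintegral_add_compl _ (isClosed_closedBall (x := (0 : ℂ)) (ε := ρ)).measurableSet]
  refine ENNReal.add_lt_top.2 ⟨?_, (hρ f).trans_lt (by finiteness)⟩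
  refine lt_of_le_of_lt (setLIntegral_mono' (g := fun _ => ENNReal.ofReal ((M * ‖f‖) ^ 2))
    isClosed_closedBall.measurableSet fun z hz => ?_) ?_
  · rw [← ofReal_norm, ← ENNReal.ofReal_pow (norm_nonneg _)]
    refine ENNReal.ofReal_le_ofReal ?_
    have := hM f z hz
    gcongr
  · rw [setLIntegral_const]
    finiteness

theorem isCompactToeplitz_of_isVanishingCarleson {ω : ℂ → ℝ} (hω : IsA2Weight ω) {ν : Measure ℂ}
    [IsFiniteMeasure ν] (hν : ν diskᶜ = 0) (h : IsVanishingCarleson ω ν) :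
    IsCompactToeplitz ω ν := by
  have := completeSpace_bergman hω
  set ρ : ℕ → ℝ := fun n => 1 - 1 / ((n : ℝ) + 1) with hρ
  have hρ1 : ∀ n, ρ n < 1 := fun n => by
    have : (0 : ℝ) < 1 / ((n : ℝ) + 1) := by positivity
    simp only [hρ]
    linarith
  have hmono : Monotone ρ := fun m n hmn => by
    have : (m : ℝ) ≤ n := by exact_mod_cast hmn
    simp only [hρ]
    gcongr
  have hlim : Tendsto ρ atTop (𝓝 1) := by
    have := tendsto_one_div_add_atTop_nhds_zero_nat (𝕜 := ℝ).const_sub 1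
    simpa [hρ] using this
  have hm : ∀ f : bergman ω, AEStronglyMeasurable (rep f) ν := fun f =>
    aestronglyMeasurable_of_harmonic hν (harmonicOnNhd_rep f)
  have htail : ∀ ε > 0, ∃ N, ∀ n ≥ N, ∀ f g : bergman ω,
      ‖∫ z in closedBall (0 : ℂ) (ρ n) \ closedBall 0 (ρ N),
        inner ℂ (kernel ω z) f * conj (inner ℂ (kernel ω z) g) ∂ν‖ ≤ ε * ‖f‖ * ‖g‖ := by
    intro ε hε
    obtain ⟨ρ₀, -, hρ₀1, hρ₀⟩ := exists_lintegral_compl_le hω hν h hε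
    obtain ⟨N, hN⟩ := (hlim.eventually (lt_mem_nhds hρ₀1)).exists
    refine ⟨N, fun n hn f g => ?_⟩
    have hsub : closedBall (0 : ℂ) (ρ n) \ closedBall 0 (ρ N) ⊆ (closedBall 0 ρ₀)ᶜ :=
      fun z hz hz' => hz.2 (closedBall_subset_closedBall hN.le hz')
    have h1 := enorm_setIntegral_mul_conj_le (hm f) (hm g)
      ((lintegral_mono_set hsub).trans (hρ₀ f)) ((lintegral_mono_set hsub).trans (hρ₀ g))
    have h2 := ENNReal.toReal_mono (by finiteness) h1
    simp only [ENNReal.toReal_mul, toReal_enorm, ENNReal.toReal_ofReal hε.le] at h2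
    refine le_of_eq_of_le (congrArg _ ?_) h2
    refine setIntegral_congr_fun (isClosed_closedBall.measurableSet.diff
      isClosed_closedBall.measurableSet) fun z hz => ?_
    have hzd := closedBall_subset_disk (hρ1 n) hz.1
    exact congrArg₂ _ (rep_eq_inner_kernel hω hzd f).symm
      (congrArg _ (rep_eq_inner_kernel hω hzd g).symm)
  obtain ⟨T, hTc, hT⟩ := exists_isCompactOperator_of_form (H := bergman ω) (μ := ν)
    (K := kernel ω) (A := fun n => closedBall 0 (ρ n))
    (fun m n hmn => closedBall_subset_closedBall (hmono hmn)) (fun n => isCompact_closedBall _ _)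
    (fun n => (continuousOn_kernel hω).mono (closedBall_subset_disk (hρ1 n))) htail
  refine ⟨T, hTc, fun f _ z hz => ?_⟩
  have hI : Integrable (fun w => rep f w * conj (rep (kernel ω z) w)) ν :=
    (memLp_rep hω hν h f).integrable_mul (memLp_rep hω hν h (kernel ω z)).star
  refine ⟨hI, ?_⟩
  have hU : (⋃ n, closedBall (0 : ℂ) (ρ n)) = disk := by
    refine Set.Subset.antisymm (Set.iUnion_subset fun n => closedBall_subset_disk (hρ1 n)) ?_
    intro w hw
    obtain ⟨n, hn⟩ := (hlim.eventually (lt_mem_nhds (mem_ball_zero_iff.1 hw))).exists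
    exact Set.mem_iUnion.2 ⟨n, mem_closedBall_zero_iff.2 hn.le⟩
  have h1 := tendsto_setIntegral_of_monotone (μ := ν)
    (f := fun w => rep f w * conj (rep (kernel ω z) w))
    (fun n => (isClosed_closedBall (x := (0 : ℂ)) (ε := ρ n)).measurableSet)
    (fun m n hmn => closedBall_subset_closedBall (hmono hmn)) hI.integrableOn
  rw [hU, Measure.restrict_eq_self_of_ae_mem (ae_iff.2 hν)] at h1
  rw [rep_eq_inner_kernel hω hz]
  refine tendsto_nhds_unique (hT f (kernel ω z)) (h1.congr fun n => ?_)
  refine setIntegral_congr_fun isClosed_closedBall.measurableSet fun w hw => ?_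
  have hwd := closedBall_subset_disk (hρ1 n) hw
  exact congrArg₂ _ (rep_eq_inner_kernel hω hwd f)
    (congrArg _ (rep_eq_inner_kernel hω hwd (kernel ω z)))

end HarmonicBergman

theorem mainTheorem2 (ω : ℂ → ℝ) (hω : HarmonicBergman.IsA2Weight ω)
    (ν : Measure ℂ) [IsFiniteMeasure ν] (hν : ν HarmonicBergman.diskᶜ = 0) :
    List.TFAE [
      HarmonicBergman.IsCompactToeplitz ω ν,
      HarmonicBergman.IsVanishingCarleson ω ν,
      Tendsto (HarmonicBergman.berezin ω ν) HarmonicBergman.toBoundary (𝓝 0)] := by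
  tfae_have 1 → 3 := HarmonicBergman.tendsto_berezin_of_isCompactToeplitz hω hν
  tfae_have 3 → 2 := HarmonicBergman.isVanishingCarleson_of_tendsto_berezin hω
  tfae_have 2 → 1 := HarmonicBergman.isCompactToeplitz_of_isVanishingCarleson hω hν
  tfae_finish
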